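/- Let $\mathbf{Top}$ be a convenient category of spaces: a full, replete subcategory of the category of topological spaces that contains the cubes $[0,1]^n$ ($n\ge 0$) and is complete, cocomplete and cartesian closed (for instance $k$-spaces, or compactly generated weak Hausdorff spaces). Let $\mathcal C$ be a topologically bicomplete category, that is, a locally small, complete and cocomplete category which is enriched, tensored and cotensored over $\mathbf{Top}$. Write $I=[0,1]$, and let $i_0,i_1\colon X\to X\otimes I$ and $p_0,p_1\colon Y^I\to Y$ be the maps induced by the endpoints of $I$. A homotopy from $f_0$ to $f_1\colon X\to Y$ is a map $h\colon X\otimes I\to Y$ with $hi_0=f_0$ and $hi_1=f_1$; this defines homotopy equivalences in $\mathcal C$. An $h$-fibration is a map with the right lifting property against $i_0\colon Z\to Z\otimes I$ for every object $Z$. A strong $h$-cofibration is a map with the left lifting property against every $h$-fibration that is a homotopy equivalence. The mapping path object $Nf$ of $f\colon X\to Y$ is the pullback of $f$ along $p_0\colon Y^I\to Y$. Suppose that $\mathcal C$ satisfies the monomorphism hypothesis: there are an orthogonal factorization system $(\mathcal E,\mathcal M)$ on $\mathcal C$ (a weak factorization system with unique liftings and factorizations) which is well-copowered (each object has, up to isomorphism,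 only a set of $\mathcal E$-quotients) and a regular cardinal $\alpha$ such that, for every object $Y$ and every $\alpha$-indexed sequence of maps $f_\beta\colon X_\beta\to Y$ over $Y$ with colimit $f_\alpha\colon X_\alpha=\operatorname{colim}_{\beta<\alpha}X_\beta\to Y$ whose colimit legs $X_\beta\to X_\alpha$ all lie in $\mathcal M$, the natural map $\operatorname{colim}_{\beta<\alpha}Nf_\beta\to Nf_\alpha$ is an isomorphism. Then there is an algebraic weak factorization system $(\mathbb C,\mathbb F)$ on $\mathcal C$ whose right class is exactly the class of $h$-fibrations and whose left class is exactly the class of strong $h$-cofibrations that are homotopy equivalences. Here an algebraic weak factorization system $(\mathbb L,\mathbb R)$ consists of a functorial factorization $X\xrightarrow{Lf}Ef\xrightarrow{Rf}Y$ of the maps $f\colon X\to Y$ of $\mathcal C$, an extension of $L$ with its canonical counit $(1,Rf)\colon Lf\to f$ to a comonad on the arrow category, with comultiplication components $\delta_f\colon Ef\to ELf$, and an extension of $R$ with its canonical unit $(Lf,1)\colon f\to Rf$ to a monad on the arrow category, with multiplication components $\mu_f\colon ERf\to Ef$, such that the transformation $(\delta_f,\mu_f)\colon LRf\to RLf$ is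 a distributive law, i.e. $\delta_f\circ\mu_f=\mu_{Lf}\circ E(\delta_f,\mu_f)\circ\delta_{Rf}$. Its left class consists of the maps admitting a coalgebra structure for the copointed endofunctor $L$, and its right class of the maps admitting an algebra structure for the pointed endofunctor $R$. -/

import Mathlib

open CategoryTheory CategoryTheory.Limits CategoryTheory.MonoidalCategory

universe v u

-- So that `X ⟶ Y` is elaborated with the standard quiver of a category.
attribute [-instance] CategoryTheory.catToReflQuiver

namespace HurewiczFactorization

/-! ### Convenient categories of spaces -/

/-- A convenient category of spaces: a full, replete subcategory of the category of topological
spaces, given by a property `P` of spaces, that contains the cubes `[0,1]ⁿ`, is complete and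
cocomplete, and is cartesian closed.  Both the category of `k`-spaces and the category of compactly
generated weak Hausdorff spaces are of this form.  The cartesian monoidal structure (a choice of
finite products in the subcategory) is data, taken as an instance argument. -/
class IsConvenient (P : ObjectProperty TopCat.{v})
    [CartesianMonoidalCategory P.FullSubcategory] : Prop where
  replete : P.IsClosedUnderIsomorphisms
  cube_mem : ∀ n : ℕ, P (TopCat.of (ULift.{v} (Fin n → unitInterval)))
  interval_mem : P (TopCat.of (ULift.{v} unitInterval))
  hasLimits : HasLimits P.FullSubcategory
  hasColimits : HasColimits P.FullSubcategory
  cartesianClosed : Nonempty (MonoidalClosed P.FullSubcategory)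

section Interval

variable (P : ObjectProperty TopCat.{v}) [CartesianMonoidalCategory P.FullSubcategory]
  [IsConvenient P]

/-- The unit interval `I`, as an object of the convenient category. -/
def interval : P.FullSubcategory :=
  ⟨TopCat.of (ULift.{v} unitInterval), IsConvenient.interval_mem⟩

/-- The point `t` of the unit interval, as a morphism `* ⟶ I`. -/
def point (t : unitInterval) : 𝟙_ P.FullSubcategory ⟶ interval P :=
  ObjectProperty.homMk (TopCat.ofHom (ContinuousMap.const _ (ULift.up t)))

end Interval

/-! ### Enriched tensors and cotensors -/

section Tensors

variable (V : Type*) [Category* V] [MonoidalCategory V]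
  {C : Type*} [Category* C] [EnrichedOrdinaryCategory V C]

/-- A tensor `X ⊗ K` of `X : C` by `K : V`: an object together with a universal
`K ⟶ C(X, X ⊗ K)`.  Universality says that maps `A ⟶ C(X ⊗ K, Y)` correspond, for all `A : V`, to
maps `K ⊗ A ⟶ C(X, Y)`; when `V` is cartesian closed this is the natural isomorphism
`C(X ⊗ K, Y) ≅ C(X, Y)^K` in `V`. -/
structure Tensor (X : C) (K : V) where
  obj : C
  coev : K ⟶ (X ⟶[V] obj)
  bijective : ∀ (A : V) (Y : C), Function.Bijective
    (fun g : A ⟶ (obj ⟶[V] Y) => (coev ⊗ₘ g) ≫ eComp V X obj Y)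

/-- A cotensor `Y^K` of `Y : C` by `K : V`: an object together with a universal
`K ⟶ C(Y^K, Y)`.  Universality says that maps `A ⟶ C(X, Y^K)` correspond, for all `A : V`, to
maps `A ⊗ K ⟶ C(X, Y)`; when `V` is cartesian closed this is the natural isomorphism
`C(X, Y^K) ≅ C(X, Y)^K` in `V`. -/
structure Cotensor (Y : C) (K : V) where
  obj : C
  ev : K ⟶ (obj ⟶[V] Y)
  bijective : ∀ (A : V) (X : C), Function.Bijective
    (fun g : A ⟶ (X ⟶[V] obj) => (g ⊗ₘ ev) ≫ eComp V X obj Y)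

end Tensors

/-- A topologically bicomplete category: a complete and cocomplete (locally small) category
enriched, tensored and cotensored over a convenient category of spaces. -/
class TopologicallyBicomplete (P : ObjectProperty TopCat.{v})
    [CartesianMonoidalCategory P.FullSubcategory] [IsConvenient P]
    (C : Type u) [Category.{v} C] extends EnrichedOrdinaryCategory P.FullSubcategory C where
  tensor : ∀ (X : C) (K : P.FullSubcategory), Tensor P.FullSubcategory X K
  cotensor : ∀ (Y : C) (K : P.FullSubcategory), Cotensor P.FullSubcategory Y K
  hasLimits : HasLimits C
  hasColimits : HasColimits C

attribute [instance] TopologicallyBicomplete.hasLimits TopologicallyBicomplete.hasColimits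

section Homotopy

variable (P : ObjectProperty TopCat.{v}) [CartesianMonoidalCategory P.FullSubcategory]
  [IsConvenient P] {C : Type u} [Category.{v} C] [TopologicallyBicomplete P C]

/-- The cylinder `X ⊗ I`. -/
abbrev cyl (X : C) : C := (TopologicallyBicomplete.tensor X (interval P)).obj

/-- The map `i_t : X ⟶ X ⊗ I` induced by the point `t` of `I`. -/
def cylIncl (t : unitInterval) (X : C) : X ⟶ cyl P X :=
  (eHomEquiv P.FullSubcategory).symm
    (point P t ≫ (TopologicallyBicomplete.tensor X (interval P)).coev)

/-- The path object `Y^I`. -/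
abbrev pathObj (Y : C) : C := (TopologicallyBicomplete.cotensor Y (interval P)).obj

/-- The map `p_t : Y^I ⟶ Y` induced by the point `t` of `I`. -/
def pathEval (t : unitInterval) (Y : C) : pathObj P Y ⟶ Y :=
  (eHomEquiv P.FullSubcategory).symm
    (point P t ≫ (TopologicallyBicomplete.cotensor Y (interval P)).ev)

/-- There is a homotopy from `f₀` to `f₁`. -/
def Homotopic {X Y : C} (f₀ f₁ : X ⟶ Y) : Prop :=
  ∃ h : cyl P X ⟶ Y, cylIncl P 0 X ≫ h = f₀ ∧ cylIncl P 1 X ≫ h = f₁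

/-- The class of homotopy equivalences. -/
def homotopyEquivalences : MorphismProperty C := fun X Y f =>
  ∃ g : Y ⟶ X, Homotopic P (f ≫ g) (𝟙 X) ∧ Homotopic P (g ≫ f) (𝟙 Y)

/-- The class of `h`-fibrations: the maps with the right lifting property against all
`i₀ : Z ⟶ Z ⊗ I`. -/
def hFibrations : MorphismProperty C := fun _ _ f =>
  ∀ Z : C, HasLiftingProperty (cylIncl P 0 Z) f

/-- The class of strong `h`-cofibrations: the maps with the left lifting property against all
`h`-fibrations that are homotopy equivalences. -/
def strongCofibrations : MorphismProperty C :=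
  (hFibrations P ⊓ homotopyEquivalences P).llp

/-- The mapping path object functor `f ↦ N f = X ×_Y Y^I`, the pullback of `f : X ⟶ Y` along
`p₀ : Y^I ⟶ Y`, restricted to the maps with a fixed codomain `Y`. -/
noncomputable def mappingPath (Y : C) : Over Y ⥤ C :=
  Over.pullback (pathEval P 0 Y) ⋙ Over.forget _

end Homotopy

/-! ### The monomorphism hypothesis -/

section Mono

variable {C : Type u} [Category.{v} C]

/-- An orthogonal factorization system: a weak factorization system in which liftings and
factorizations are unique (factorizations up to a unique isomorphism, which follows from the
uniqueness of liftings). -/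
structure IsOrthogonalFactorizationSystem (E M : MorphismProperty C) : Prop where
  isWeakFactorizationSystem : MorphismProperty.IsWeakFactorizationSystem E M
  lift_unique : ∀ {A B X Y : C} (e : A ⟶ B) (m : X ⟶ Y), E e → M m →
    ∀ l₁ l₂ : B ⟶ X, e ≫ l₁ = e ≫ l₂ → l₁ ≫ m = l₂ ≫ m → l₁ = l₂

/-- Every object has only a set of `E`-quotients, up to isomorphism under the object. -/
def IsWellCopowered (E : MorphismProperty C) : Prop :=
  ∀ X : C, ∃ (ι : Type v) (Q : ι → Under X), ∀ q : Under X, E q.hom → ∃ i, Nonempty (q ≅ Q i)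

/-- The monomorphism hypothesis: for some well-copowered orthogonal factorization system `(E, M)`
and some regular cardinal `α`, the mapping path object functor preserves the colimits of
`α`-indexed sequences `f_β : X_β ⟶ Y` over a fixed object `Y` all of whose colimit legs
`X_β ⟶ colim X_β` are in `M`. -/
def MonomorphismHypothesis (P : ObjectProperty TopCat.{v})
    [CartesianMonoidalCategory P.FullSubcategory] [IsConvenient P]
    (C : Type u) [Category.{v} C] [TopologicallyBicomplete P C] : Prop :=
  ∃ E M : MorphismProperty C, IsOrthogonalFactorizationSystem E M ∧ IsWellCopowered E ∧
    ∃ α : Cardinal.{v}, α.IsRegular ∧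
      ∀ (Y : C) (f : α.ord.ToType ⥤ Over Y) (c : Cocone f),
        Nonempty (IsColimit ((Over.forget Y).mapCocone c)) →
        (∀ β, M (c.ι.app β).left) →
        Nonempty (IsColimit ((mappingPath P Y).mapCocone c))

end Mono

/-! ### Algebraic weak factorization systems -/

/-- A functorial factorization, sending `f : X ⟶ Y` to `X ⟶ E f ⟶ Y`, naturally in `f`. -/
structure FunctorialFactorization (C : Type u) [Category.{v} C] where
  E : Arrow C ⥤ C
  left : ∀ f : Arrow C, f.left ⟶ E.obj f
  right : ∀ f : Arrow C, E.obj f ⟶ f.right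
  left_naturality : ∀ {f g : Arrow C} (φ : f ⟶ g), φ.left ≫ left g = left f ≫ E.map φ
  right_naturality : ∀ {f g : Arrow C} (φ : f ⟶ g), E.map φ ≫ right g = right f ≫ φ.right
  fac : ∀ f : Arrow C, left f ≫ right f = f.hom

namespace FunctorialFactorization

variable {C : Type u} [Category.{v} C] (W : FunctorialFactorization C)

/-- The left factor, as an endofunctor of the arrow category. -/
@[simps]
def L : Arrow C ⥤ Arrow C where
  obj f := Arrow.mk (W.left f)
  map {f g} φ := Arrow.homMk' φ.left (W.E.map φ) (W.left_naturality φ)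

/-- The right factor, as an endofunctor of the arrow category. -/
@[simps]
def R : Arrow C ⥤ Arrow C where
  obj f := Arrow.mk (W.right f)
  map {f g} φ := Arrow.homMk' (W.E.map φ) φ.right (W.right_naturality φ)

/-- The canonical natural transformation `L ⟶ 𝟭`, with components `(𝟙, R f)`. -/
@[simps]
def ε : W.L ⟶ 𝟭 (Arrow C) where
  app f := Arrow.homMk (f := W.L.obj f) (g := f) (𝟙 f.left) (W.right f)
    ((Category.id_comp _).trans (W.fac f).symm)
  naturality f g φ := by
    ext
    · exact (Category.comp_id _).trans (Category.id_comp _).symm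
    · exact W.right_naturality φ

/-- The canonical natural transformation `𝟭 ⟶ R`, with components `(L f, 𝟙)`. -/
@[simps]
def η : 𝟭 (Arrow C) ⟶ W.R where
  app f := Arrow.homMk (f := f) (g := W.R.obj f) (W.left f) (𝟙 f.right)
    ((W.fac f).trans (Category.comp_id _).symm)
  naturality f g φ := by
    ext
    · exact W.left_naturality φ
    · exact (Category.comp_id _).trans (Category.id_comp _).symm

/-- The left class: the maps that admit a coalgebra structure for the pointed endofunctor `L`. -/
def leftClass : MorphismProperty C := fun _ _ f =>
  ∃ s : Arrow.mk f ⟶ W.L.obj (Arrow.mk f), s ≫ W.ε.app (Arrow.mk f) = 𝟙 (Arrow.mk f)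

/-- The right class: the maps that admit an algebra structure for the pointed endofunctor `R`. -/
def rightClass : MorphismProperty C := fun _ _ f =>
  ∃ s : W.R.obj (Arrow.mk f) ⟶ Arrow.mk f, W.η.app (Arrow.mk f) ≫ s = 𝟙 (Arrow.mk f)

end FunctorialFactorization

/-- A functorial factorization with an extension of `(L, ε)` to a comonad `(L, ε, δ)` and of
`(R, η)` to a monad `(R, η, μ)` on the arrow category. -/
structure MonadicFactorization (C : Type u) [Category.{v} C] extends
    FunctorialFactorization C where
  δ : toFunctorialFactorization.L ⟶ toFunctorialFactorization.L ⋙ toFunctorialFactorization.L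
  coassoc : ∀ f : Arrow C, δ.app f ≫ toFunctorialFactorization.L.map (δ.app f) =
    δ.app f ≫ δ.app (toFunctorialFactorization.L.obj f)
  left_counit : ∀ f : Arrow C,
    δ.app f ≫ toFunctorialFactorization.ε.app (toFunctorialFactorization.L.obj f) = 𝟙 _
  right_counit : ∀ f : Arrow C,
    δ.app f ≫ toFunctorialFactorization.L.map (toFunctorialFactorization.ε.app f) = 𝟙 _
  μ : toFunctorialFactorization.R ⋙ toFunctorialFactorization.R ⟶ toFunctorialFactorization.R
  assoc : ∀ f : Arrow C, toFunctorialFactorization.R.map (μ.app f) ≫ μ.app f =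
    μ.app (toFunctorialFactorization.R.obj f) ≫ μ.app f
  left_unit : ∀ f : Arrow C,
    toFunctorialFactorization.η.app (toFunctorialFactorization.R.obj f) ≫ μ.app f = 𝟙 _
  right_unit : ∀ f : Arrow C,
    toFunctorialFactorization.R.map (toFunctorialFactorization.η.app f) ≫ μ.app f = 𝟙 _

namespace MonadicFactorization

variable {C : Type u} [Category.{v} C] (W : MonadicFactorization C)

/-- The comonad `(L, ε, δ)`. -/
def comonad : Comonad (Arrow C) where
  toFunctor := W.L
  ε := W.ε
  δ := W.δ
  coassoc := W.coassoc
  left_counit := W.left_counit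
  right_counit := W.right_counit

/-- The monad `(R, η, μ)`. -/
def monad : Monad (Arrow C) where
  toFunctor := W.R
  η := W.η
  μ := W.μ
  assoc := W.assoc
  left_unit := W.left_unit
  right_unit := W.right_unit

/-- The nontrivial component `δ_f : E f ⟶ E (L f)` of the comultiplication. -/
def comult (f : Arrow C) : W.E.obj f ⟶ W.E.obj (W.L.obj f) := (W.δ.app f).right

/-- The nontrivial component `μ_f : E (R f) ⟶ E f` of the multiplication. -/
def mult (f : Arrow C) : W.E.obj (W.R.obj f) ⟶ W.E.obj f := (W.μ.app f).left

/-- The component at `f` of `Δ : L R ⟶ R L`: the square with top `δ_f`, bottom `μ_f`, left side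
`L (R f)` and right side `R (L f)`. -/
def Δ (f : Arrow C) : W.L.obj (W.R.obj f) ⟶ W.R.obj (W.L.obj f) :=
  Arrow.homMk (f := W.L.obj (W.R.obj f)) (g := W.R.obj (W.L.obj f)) (W.comult f) (W.mult f)
    ((congrArg CommaMorphism.right (W.left_counit f)).trans
      (congrArg CommaMorphism.left (W.left_unit f)).symm)

end MonadicFactorization

/-- An algebraic weak factorization system: a functorial factorization whose left factor is a
comonad and whose right factor is a monad, such that `Δ : L R ⟶ R L` is a distributive law, that is,
`δ_f ∘ μ_f = μ_{L f} ∘ E(δ_f, μ_f) ∘ δ_{R f}`. -/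
structure AlgebraicWeakFactorizationSystem (C : Type u) [Category.{v} C] extends
    MonadicFactorization C where
  distributive : ∀ f : Arrow C,
    toMonadicFactorization.mult f ≫ toMonadicFactorization.comult f =
      toMonadicFactorization.comult (toMonadicFactorization.R.obj f) ≫
        toMonadicFactorization.E.map (toMonadicFactorization.Δ f) ≫
          toMonadicFactorization.mult (toMonadicFactorization.L.obj f)

end HurewiczFactorization

namespace HurewiczFactorization

/-! A choice of lifts of `f` against all inclusions `i Z`, natural in `Z`, is called a cleavage.
Since lifting problems are represented by the mapping path object `N f`, a single lift of the
universal problem already gives a cleavage. Hence the h-fibrations are exactly the maps admitting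
one (`nonempty_cleavage_iff`), and naturality costs nothing.

Suppose that every `f` factors as `X ⟶ E f ⟶ Y` with the second map carrying the free cleavage on
`f`. Because cleavages compose, this universal property yields both the comultiplication and the
multiplication. Every law of an algebraic weak factorization system compares two cleavage-preserving
maps out of a free object, so it suffices to compare them after restriction along the unit
(`FreeCleavage.awfs`, with `mult_comult` for distributivity).

Free cleavages are built over a fixed `Y`. Partial cleavages, families of chosen lifts indexed by an
object `W`, form a cocomplete comma category in which cleavages are the objects with `W ⟶ N B`
invertible. To reflect the empty partial cleavage on `f` into these, one freely adjoins solutions of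
all lifting problems, transfinitely often (`isLocal_toSucc`). `N` is only known to preserve colimits
of sequences with legs in `M`, so the sequence is interleaved with steps realizing in advance every
`E`-quotient that could arise later (`exists_isStable`). The `(E, M)`-images in the colimit then
interleave with the sequence itself, and the hypothesis applied to the images shows that the colimit
is total (`isTotal_of_isColimit`). Well-copoweredness bounds the set of quotients and also forces
`E` to consist of epimorphisms.

Finally, the left class consists of the maps lifting against all h-fibrations. Such maps are
homotopy equivalences, by lifting against the end point projection of the mapping path object
(`homotopyEquivalences_of_llp`). Conversely, a strong h-cofibration that is a homotopy equivalence
is handled by the retract argument. -/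

/-- A natural cylinder inclusion `Z ⟶ T Z`, for a functor `T` with a right adjoint `G`. -/
structure Cylinder (C : Type u) [Category.{v} C] where
  T : C ⥤ C
  G : C ⥤ C
  adj : T ⊣ G
  i : ∀ Z : C, Z ⟶ T.obj Z
  i_naturality : ∀ {Z Z' : C} (k : Z ⟶ Z'), k ≫ i Z' = i Z ≫ T.map k

/-! ### Cleavages: morphisms, composition and pullback. -/

section Cleavages

variable {C : Type u} [Category.{v} C] (I : Cylinder C)

/-- A cleavage of `f`: a lift against each `i Z : Z ⟶ T Z`, chosen naturally in `Z`. -/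
structure Cleavage {X Y : C} (f : X ⟶ Y) where
  fill : ∀ {Z : C} (a : Z ⟶ X) (b : I.T.obj Z ⟶ Y), a ≫ f = I.i Z ≫ b → (I.T.obj Z ⟶ X)
  incl_fill : ∀ {Z : C} (a : Z ⟶ X) (b : I.T.obj Z ⟶ Y) (h : a ≫ f = I.i Z ≫ b),
    I.i Z ≫ fill a b h = a
  fill_comp : ∀ {Z : C} (a : Z ⟶ X) (b : I.T.obj Z ⟶ Y) (h : a ≫ f = I.i Z ≫ b),
    fill a b h ≫ f = b
  map_fill : ∀ {Z' Z : C} (k : Z' ⟶ Z) (a : Z ⟶ X) (b : I.T.obj Z ⟶ Y)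
    (h : a ≫ f = I.i Z ≫ b), I.T.map k ≫ fill a b h =
      fill (k ≫ a) (I.T.map k ≫ b)
        (by rw [Category.assoc, h, ← Category.assoc, I.i_naturality, Category.assoc])

attribute [simp] Cleavage.incl_fill Cleavage.fill_comp

variable {I}

namespace Cleavage

lemma fill_congr {X Y : C} {f : X ⟶ Y} (φ : Cleavage I f) {Z : C} {a a' : Z ⟶ X}
    {b b' : I.T.obj Z ⟶ Y} (ha : a = a') (hb : b = b') (h : a ≫ f = I.i Z ≫ b) :
    φ.fill a b h = φ.fill a' b' (by rw [← ha, ← hb, h]) := by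
  subst ha hb; rfl

/-- A square `(u, v)` from `f` to `g` that is compatible with chosen lifts. -/
structure IsHom {X Y X' Y' : C} {f : X ⟶ Y} {g : X' ⟶ Y'} (φ : Cleavage I f) (ψ : Cleavage I g)
    (u : X ⟶ X') (v : Y ⟶ Y') : Prop where
  w : u ≫ g = f ≫ v
  fill_comp : ∀ {Z : C} (a : Z ⟶ X) (b : I.T.obj Z ⟶ Y) (h : a ≫ f = I.i Z ≫ b),
    φ.fill a b h ≫ u = ψ.fill (a ≫ u) (b ≫ v)
      (by rw [Category.assoc, w, reassoc_of% h])

lemma IsHom.id {X Y : C} {f : X ⟶ Y} (φ : Cleavage I f) : IsHom φ φ (𝟙 X) (𝟙 Y) where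
  w := by simp
  fill_comp a b h := by
    rw [Category.comp_id]
    exact fill_congr _ (Category.comp_id _).symm (Category.comp_id _).symm _

lemma IsHom.comp {X Y X' Y' X'' Y'' : C} {f : X ⟶ Y} {g : X' ⟶ Y'} {k : X'' ⟶ Y''}
    {φ : Cleavage I f} {ψ : Cleavage I g} {χ : Cleavage I k} {u : X ⟶ X'} {v : Y ⟶ Y'}
    {u' : X' ⟶ X''} {v' : Y' ⟶ Y''} (h : IsHom φ ψ u v) (h' : IsHom ψ χ u' v') :
    IsHom φ χ (u ≫ u') (v ≫ v') where
  w := by rw [Category.assoc, h'.w, reassoc_of% h.w]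
  fill_comp a b e := by
    rw [← Category.assoc, h.fill_comp, h'.fill_comp]
    exact fill_congr _ (Category.assoc _ _ _) (Category.assoc _ _ _) _

lemma IsHom.of_eq {X Y X' Y' : C} {f : X ⟶ Y} {g : X' ⟶ Y'} {φ : Cleavage I f}
    {ψ : Cleavage I g} {u u' : X ⟶ X'} {v v' : Y ⟶ Y'} (h : IsHom φ ψ u v) (hu : u = u')
    (hv : v = v') : IsHom φ ψ u' v' := by
  subst hu hv; exact h

/-- The composite of two maps with cleavages. -/
@[simps]
def comp {X Y Z : C} {f : X ⟶ Y} {g : Y ⟶ Z} (φ : Cleavage I f) (ψ : Cleavage I g) :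
    Cleavage I (f ≫ g) where
  fill a b h := φ.fill a (ψ.fill (a ≫ f) b (by rw [Category.assoc, h])) (by simp)
  incl_fill _ _ _ := φ.incl_fill _ _ _
  fill_comp a b h := by rw [← Category.assoc, φ.fill_comp, ψ.fill_comp]
  map_fill k a b h := by
    rw [map_fill]
    exact fill_congr _ rfl ((map_fill _ _ _ _ _).trans
      (fill_congr _ (Category.assoc _ _ _).symm rfl _)) _

lemma IsHom.vcomp {X Y Z X' Y' Z' : C} {f : X ⟶ Y} {g : Y ⟶ Z} {f' : X' ⟶ Y'} {g' : Y' ⟶ Z'}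
    {φ : Cleavage I f} {ψ : Cleavage I g} {φ' : Cleavage I f'} {ψ' : Cleavage I g'}
    {u : X ⟶ X'} {v : Y ⟶ Y'} {w : Z ⟶ Z'} (h : IsHom φ φ' u v) (h' : IsHom ψ ψ' v w) :
    IsHom (φ.comp ψ) (φ'.comp ψ') u w where
  w := by rw [Category.assoc, ← h'.w, reassoc_of% h.w]
  fill_comp a b e := by
    rw [comp_fill, comp_fill, h.fill_comp]
    refine fill_congr _ rfl ?_ _
    rw [h'.fill_comp]
    refine fill_congr _ ?_ rfl _
    rw [Category.assoc, Category.assoc, h.w]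

/-- Here `g` is both the lower factor and the bottom edge of the square. A composite lift is a
`φ`-lift over a `ψ`-lift of `b`, and the latter followed by `g` is `b` again, whatever `ψ` is. -/
lemma IsHom.of_comp {X Y Z X' : C} {f : X ⟶ Y} {g : Y ⟶ Z} {k : X' ⟶ Z} {φ : Cleavage I f}
    {ψ : Cleavage I g} {χ : Cleavage I k} {u : X ⟶ X'} (h : IsHom φ χ u g) :
    IsHom (φ.comp ψ) χ u (𝟙 Z) where
  w := by rw [h.w, Category.comp_id]
  fill_comp a b e := by
    rw [comp_fill, h.fill_comp]
    exact fill_congr _ rfl (by simp) _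

lemma isHom_comp_assoc {X Y Z W : C} {f : X ⟶ Y} {g : Y ⟶ Z} {k : Z ⟶ W} (φ : Cleavage I f)
    (ψ : Cleavage I g) (χ : Cleavage I k) :
    IsHom ((φ.comp ψ).comp χ) (φ.comp (ψ.comp χ)) (𝟙 X) (𝟙 W) where
  w := by simp
  fill_comp a b e := by
    simp only [comp_fill]
    rw [Category.comp_id]
    refine fill_congr _ (Category.comp_id _).symm ?_ _
    refine fill_congr _ (by simp) ?_ _
    exact fill_congr _ (by simp) (by simp) _

lemma isHom_comp_right {X Y Z : C} {f : X ⟶ Y} {g : Y ⟶ Z} (φ : Cleavage I f)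
    (ψ : Cleavage I g) : IsHom (φ.comp ψ) ψ f (𝟙 Z) where
  w := by simp
  fill_comp a b e := by
    rw [comp_fill, φ.fill_comp]
    exact fill_congr _ rfl (by simp) _

/-- The cleavage of a pullback. -/
noncomputable def pullback [HasPullbacks C] {X Y Y' : C} {g : X ⟶ Y} (ψ : Cleavage I g) (v : Y' ⟶ Y) :
    Cleavage I (pullback.snd g v) where
  fill a b h := pullback.lift (ψ.fill (a ≫ pullback.fst g v) (b ≫ v)
      (by rw [Category.assoc, pullback.condition, reassoc_of% h])) b (by simp)
  incl_fill a b h := by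
    ext
    · rw [Category.assoc, pullback.lift_fst, incl_fill]
    · rw [Category.assoc, pullback.lift_snd, h]
  fill_comp a b h := pullback.lift_snd _ _ _
  map_fill k a b h := by
    ext
    · rw [Category.assoc, pullback.lift_fst, pullback.lift_fst, map_fill]
      exact fill_congr _ (Category.assoc _ _ _).symm (Category.assoc _ _ _).symm _
    · rw [Category.assoc, pullback.lift_snd, pullback.lift_snd]

lemma isHom_pullback_fst [HasPullbacks C] {X Y Y' : C} {g : X ⟶ Y} (ψ : Cleavage I g)
    (v : Y' ⟶ Y) : IsHom (ψ.pullback v) ψ (pullback.fst g v) v where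
  w := pullback.condition
  fill_comp _ _ _ := pullback.lift_fst _ _ _

/-- Pullback squares are cartesian for morphisms of cleavages. This reduces universal properties
over varying bases to a fixed base. -/
lemma IsHom.pullback_lift [HasPullbacks C] {X Y Y' W : C} {g : X ⟶ Y} {ψ : Cleavage I g}
    {f : W ⟶ Y'} {φ : Cleavage I f} {u : W ⟶ X} {v : Y' ⟶ Y} (h : IsHom φ ψ u v) :
    IsHom φ (ψ.pullback v) (pullback.lift u f h.w) (𝟙 Y') where
  w := by rw [pullback.lift_snd, Category.comp_id]
  fill_comp a b e := by
    ext
    · rw [Category.assoc, pullback.lift_fst, h.fill_comp]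
      refine Eq.trans ?_ (pullback.lift_fst _ _ _).symm
      exact fill_congr _ (by rw [Category.assoc, pullback.lift_fst]) (by simp) _
    · refine (Category.assoc _ _ _).trans ?_
      refine Eq.trans ?_ ((ψ.pullback v).fill_comp _ _ _).symm
      rw [pullback.lift_snd, φ.fill_comp, Category.comp_id]

end Cleavage

/-- A free cleavage on `f`: a factorization of `f` through a map with a cleavage, that is universal
among squares from `f` to maps with a cleavage. -/
structure FreeCleavage (I : Cylinder C) {X Y : C} (f : X ⟶ Y) where
  E : C
  l : X ⟶ E
  r : E ⟶ Y
  fac : l ≫ r = f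
  cleavage : Cleavage I r
  desc : ∀ {X' Y' : C} {g : X' ⟶ Y'} (_ : Cleavage I g) (u : X ⟶ X') (v : Y ⟶ Y'),
    u ≫ g = f ≫ v → (E ⟶ X')
  l_desc : ∀ {X' Y' : C} {g : X' ⟶ Y'} (ψ : Cleavage I g) (u : X ⟶ X') (v : Y ⟶ Y')
    (w : u ≫ g = f ≫ v), l ≫ desc ψ u v w = u
  isHom_desc : ∀ {X' Y' : C} {g : X' ⟶ Y'} (ψ : Cleavage I g) (u : X ⟶ X') (v : Y ⟶ Y')
    (w : u ≫ g = f ≫ v), cleavage.IsHom ψ (desc ψ u v w) v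
  hom_ext : ∀ {X' Y' : C} {g : X' ⟶ Y'} (ψ : Cleavage I g) (v : Y ⟶ Y') (e e' : E ⟶ X'),
    cleavage.IsHom ψ e v → cleavage.IsHom ψ e' v → l ≫ e = l ≫ e' → e = e'

attribute [simp] FreeCleavage.l_desc

/-! ### The algebraic weak factorization system of free cleavages, and its two classes. -/

namespace FreeCleavage

variable (F : ∀ {X Y : C} (f : X ⟶ Y), FreeCleavage I f)

/-- The map between free cleavages induced by a square. -/
def map {X Y X' Y' : C} (f : X ⟶ Y) (g : X' ⟶ Y') (u : X ⟶ X') (v : Y ⟶ Y')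
    (w : u ≫ g = f ≫ v) : (F f).E ⟶ (F g).E :=
  (F f).desc (F g).cleavage (u ≫ (F g).l) v (by rw [Category.assoc, (F g).fac, w])

section

variable {X Y X' Y' X'' Y'' : C} (f : X ⟶ Y) (g : X' ⟶ Y') (k : X'' ⟶ Y'') (u : X ⟶ X')
  (v : Y ⟶ Y') (w : u ≫ g = f ≫ v) (u' : X' ⟶ X'') (v' : Y' ⟶ Y'') (w' : u' ≫ k = g ≫ v')

lemma isHom_map : (F f).cleavage.IsHom (F g).cleavage (map F f g u v w) v :=
  (F f).isHom_desc _ _ _ _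

lemma l_map : (F f).l ≫ map F f g u v w = u ≫ (F g).l :=
  (F f).l_desc _ _ _ _

lemma map_r : map F f g u v w ≫ (F g).r = (F f).r ≫ v :=
  (isHom_map F f g u v w).w

lemma map_id : map F f f (𝟙 X) (𝟙 Y) (by simp) = 𝟙 _ :=
  (F f).hom_ext (F f).cleavage (𝟙 _) _ _ (isHom_map F ..) (Cleavage.IsHom.id _) (by simp [l_map])

lemma map_comp : map F f k (u ≫ u') (v ≫ v') (by rw [Category.assoc, w', reassoc_of% w]) =
    map F f g u v w ≫ map F g k u' v' w' :=
  (F f).hom_ext (F k).cleavage (v ≫ v') _ _ (isHom_map F ..)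
    ((isHom_map F ..).comp (isHom_map F ..)) (by
      rw [l_map, reassoc_of% l_map F f g, l_map, Category.assoc])

/-- The comultiplication `E f ⟶ E (L f)`. -/
def comult : (F f).E ⟶ (F (F f).l).E :=
  (F f).desc ((F (F f).l).cleavage.comp (F f).cleavage) (F (F f).l).l (𝟙 _) (by
    rw [← Category.assoc, (F (F f).l).fac, (F f).fac, Category.comp_id])

lemma l_comult : (F f).l ≫ comult F f = (F (F f).l).l :=
  (F f).l_desc _ _ _ _

lemma isHom_comult : (F f).cleavage.IsHom ((F (F f).l).cleavage.comp (F f).cleavage)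
    (comult F f) (𝟙 _) :=
  (F f).isHom_desc _ _ _ _

/-- The multiplication `E (R f) ⟶ E f`. -/
def mult : (F (F f).r).E ⟶ (F f).E :=
  (F (F f).r).desc (F f).cleavage (𝟙 _) (𝟙 _) (by simp)

lemma l_mult : (F (F f).r).l ≫ mult F f = 𝟙 _ :=
  (F (F f).r).l_desc _ _ _ _

lemma isHom_mult : (F (F f).r).cleavage.IsHom (F f).cleavage (mult F f) (𝟙 _) :=
  (F (F f).r).isHom_desc _ _ _ _

lemma mult_r : mult F f ≫ (F f).r = (F (F f).r).r :=
  (isHom_mult F f).w.trans (Category.comp_id _)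

lemma comult_r : comult F f ≫ (F (F f).l).r = 𝟙 _ := by
  refine (F f).hom_ext (F f).cleavage (𝟙 _) _ _ ?_ (Cleavage.IsHom.id _) ?_
  · exact ((isHom_comult F f).comp (Cleavage.isHom_comp_right _ _)).of_eq rfl (by simp)
  · rw [reassoc_of% l_comult F f, (F (F f).l).fac, Category.comp_id]

lemma comult_naturality : map F f g u v w ≫ comult F g =
    comult F f ≫ map F (F f).l (F g).l u (map F f g u v w) (l_map F ..).symm := by
  refine (F f).hom_ext ((F (F g).l).cleavage.comp (F g).cleavage) v _ _ ?_ ?_ ?_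
  · exact ((isHom_map F f g u v w).comp (isHom_comult F g)).of_eq rfl (by simp)
  · exact ((isHom_comult F f).comp ((isHom_map F (F f).l (F g).l u (map F f g u v w) _).vcomp
      (isHom_map F f g u v w))).of_eq rfl (by simp)
  · rw [reassoc_of% l_map F f g u v w, l_comult, reassoc_of% l_comult F f, l_map]

lemma mult_naturality :
    map F (F f).r (F g).r (map F f g u v w) v (map_r F ..) ≫ mult F g =
      mult F f ≫ map F f g u v w := by
  refine (F (F f).r).hom_ext (F g).cleavage v _ _ ?_ ?_ ?_
  · exact ((isHom_map F (F f).r (F g).r _ v _).comp (isHom_mult F g)).of_eq rfl (by simp)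
  · exact ((isHom_mult F f).comp (isHom_map F f g u v w)).of_eq rfl (by simp)
  · rw [reassoc_of% l_map F (F f).r (F g).r, l_mult, reassoc_of% l_mult F f, Category.comp_id]

lemma comult_coassoc :
    comult F f ≫ map F (F f).l (F (F f).l).l (𝟙 _) (comult F f)
      ((Category.id_comp _).trans (l_comult F f).symm) = comult F f ≫ comult F (F f).l := by
  refine (F f).hom_ext ((F (F (F f).l).l).cleavage.comp
    ((F (F f).l).cleavage.comp (F f).cleavage)) (𝟙 _) _ _ ?_ ?_ ?_
  · exact ((isHom_comult F f).comp ((isHom_map F (F f).l (F (F f).l).l (𝟙 _) (comult F f) _).vcomp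
      (isHom_comult F f))).of_eq rfl (by simp)
  · exact (((isHom_comult F f).comp ((isHom_comult F (F f).l).vcomp
      (Cleavage.IsHom.id _))).comp (Cleavage.isHom_comp_assoc _ _ _)).of_eq (by simp) (by simp)
  · rw [reassoc_of% l_comult F f, reassoc_of% l_comult F f, l_map, l_comult, Category.id_comp]

lemma comult_map_r :
    comult F f ≫ map F (F f).l f (𝟙 _) (F f).r ((Category.id_comp _).trans (F f).fac.symm) =
      𝟙 _ := by
  refine (F f).hom_ext (F f).cleavage (𝟙 _) _ _ ?_ (Cleavage.IsHom.id _) ?_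
  · exact (isHom_comult F f).comp (isHom_map F (F f).l f _ _ _).of_comp |>.of_eq rfl (by simp)
  · rw [reassoc_of% l_comult F f, l_map, Category.id_comp, Category.comp_id]

lemma mult_assoc :
    map F (F (F f).r).r (F f).r (mult F f) (𝟙 _) ((mult_r F f).trans (Category.comp_id _).symm) ≫
      mult F f = mult F (F f).r ≫ mult F f := by
  refine (F (F (F f).r).r).hom_ext (F f).cleavage (𝟙 _) _ _ ?_ ?_ ?_
  · exact ((isHom_map F (F (F f).r).r (F f).r _ _ _).comp (isHom_mult F f)).of_eq rfl (by simp)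
  · exact ((isHom_mult F (F f).r).comp (isHom_mult F f)).of_eq rfl (by simp)
  · rw [reassoc_of% l_map F (F (F f).r).r, l_mult, reassoc_of% l_mult F (F f).r, Category.comp_id]

lemma map_l_mult :
    map F f (F f).r (F f).l (𝟙 _) ((F f).fac.trans (Category.comp_id _).symm) ≫ mult F f =
      𝟙 _ := by
  refine (F f).hom_ext (F f).cleavage (𝟙 _) _ _ ?_ (Cleavage.IsHom.id _) ?_
  · exact ((isHom_map F f (F f).r _ _ _).comp (isHom_mult F f)).of_eq rfl (by simp)
  · rw [reassoc_of% l_map F f (F f).r, l_mult]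

/-- Both sides preserve cleavages, with the composite cleavage on the target, and both restrict to
`comult F f` along the unit. On the right this needs two squares stacked vertically, the lower one
being `mult F f` over the identity. -/
lemma mult_comult :
    mult F f ≫ comult F f = comult F (F f).r ≫
      map F (F (F f).r).l (F (F f).l).r (comult F f) (mult F f)
        ((comult_r F f).trans (l_mult F f).symm) ≫ mult F (F f).l := by
  refine (F (F f).r).hom_ext ((F (F f).l).cleavage.comp (F f).cleavage) (𝟙 _) _ _ ?_ ?_ ?_
  · exact ((isHom_mult F f).comp (isHom_comult F f)).of_eq rfl (by simp)
  · exact ((isHom_comult F (F f).r).comp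
      (((isHom_map F (F (F f).r).l (F (F f).l).r _ _ _).comp (isHom_mult F (F f).l)).vcomp
        ((isHom_mult F f).of_eq (Category.comp_id _).symm rfl))).of_eq rfl (by simp)
  · rw [reassoc_of% l_mult F f, reassoc_of% l_comult F (F f).r,
      reassoc_of% l_map F (F (F f).r).l (F (F f).l).r, l_mult, Category.comp_id]

end

/-- The functorial factorization given by free cleavages. -/
@[simps]
def functorialFactorization : FunctorialFactorization C where
  E :=
    { obj f := (F f.hom).E
      map {f g} φ := map F f.hom g.hom φ.left φ.right (Arrow.w φ)
      map_id f := map_id F f.hom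
      map_comp {f g k} φ ψ := map_comp F f.hom g.hom k.hom φ.left φ.right (Arrow.w φ) ψ.left
        ψ.right (Arrow.w ψ) }
  left f := (F f.hom).l
  right f := (F f.hom).r
  left_naturality {f g} φ := (l_map F f.hom g.hom φ.left φ.right (Arrow.w φ)).symm
  right_naturality {f g} φ := map_r F f.hom g.hom φ.left φ.right (Arrow.w φ)
  fac f := (F f.hom).fac

/-- The algebraic weak factorization system given by free cleavages. -/
def awfs : AlgebraicWeakFactorizationSystem C where
  toFunctorialFactorization := functorialFactorization F
  δ :=
    { app f := Arrow.homMk (f := Arrow.mk (F f.hom).l) (g := Arrow.mk (F (F f.hom).l).l)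
        (𝟙 f.left) (comult F f.hom) ((Category.id_comp (F (F f.hom).l).l).trans (l_comult F f.hom).symm)
      naturality f g φ := by
        ext
        · exact (Category.comp_id _).trans (Category.id_comp _).symm
        · exact comult_naturality F f.hom g.hom φ.left φ.right (Arrow.w φ) }
  coassoc f := by
    ext
    · rfl
    · exact comult_coassoc F f.hom
  left_counit f := by
    ext
    · exact Category.id_comp _
    · exact comult_r F f.hom
  right_counit f := by
    ext
    · exact Category.id_comp _
    · exact comult_map_r F f.hom
  μ :=
    { app f := Arrow.homMk (f := Arrow.mk (F (F f.hom).r).r) (g := Arrow.mk (F f.hom).r)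
        (mult F f.hom) (𝟙 f.right) ((mult_r F f.hom).trans (Category.comp_id (F (F f.hom).r).r).symm)
      naturality f g φ := by
        ext
        · exact mult_naturality F f.hom g.hom φ.left φ.right (Arrow.w φ)
        · exact (Category.comp_id _).trans (Category.id_comp _).symm }
  assoc f := by
    ext
    · exact mult_assoc F f.hom
    · rfl
  left_unit f := by
    ext
    · exact l_mult F f.hom
    · exact Category.id_comp _
  right_unit f := by
    ext
    · exact map_l_mult F f.hom
    · exact Category.id_comp _
  distributive f := mult_comult F f.hom

/-- An algebra structure exhibits `f` as a retract over `Y` of its free right factor, and lifts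
transfer along the retraction. Associativity of the algebra plays no role. -/
lemma awfs_rightClass {X Y : C} (f : X ⟶ Y) :
    (awfs F).rightClass f ↔ Nonempty (Cleavage I f) := by
  constructor
  · rintro ⟨s, hs⟩
    let s₀ : (F f).E ⟶ X := s.left
    have h₁ : (F f).l ≫ s₀ = 𝟙 X := congrArg CommaMorphism.left hs
    let s₁ : Y ⟶ Y := s.right
    have h₂ : 𝟙 Y ≫ s₁ = 𝟙 Y := congrArg CommaMorphism.right hs
    have hw : s₀ ≫ f = (F f).r ≫ s₁ := Arrow.w s
    have h₃ : s₀ ≫ f = (F f).r := by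
      rw [hw, ← Category.id_comp s₁, h₂, Category.comp_id]
    exact ⟨{
      fill a b h := (F f).cleavage.fill (a ≫ (F f).l) b
        (by rw [Category.assoc, (F f).fac, h]) ≫ s₀
      incl_fill a b h := by
        rw [← Category.assoc, Cleavage.incl_fill, Category.assoc, h₁, Category.comp_id]
      fill_comp a b h := by rw [Category.assoc, h₃, Cleavage.fill_comp]
      map_fill k a b h := by
        rw [← Category.assoc, Cleavage.map_fill]
        exact congrArg (· ≫ s₀) (Cleavage.fill_congr _ (Category.assoc _ _ _).symm rfl _) }⟩
  · rintro ⟨ψ⟩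
    have w : 𝟙 X ≫ f = f ≫ 𝟙 Y := by simp
    refine ⟨Arrow.homMk (f := Arrow.mk (F f).r) (g := Arrow.mk f)
      ((F f).desc ψ (𝟙 X) (𝟙 Y) w) (𝟙 Y) ((F f).isHom_desc ψ _ _ w).w, ?_⟩
    ext
    · exact (F f).l_desc ψ _ _ w
    · exact Category.comp_id _

lemma awfs_leftClass_of_hasLiftingProperty {X Y : C} (f : X ⟶ Y)
    [HasLiftingProperty f (F f).r] : (awfs F).leftClass f := by
  have sq : CommSq (F f).l f (F f).r (𝟙 Y) := ⟨by rw [(F f).fac, Category.comp_id]⟩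
  refine ⟨Arrow.homMk (f := Arrow.mk f) (g := Arrow.mk (F f).l) (𝟙 X) sq.lift
    ((Category.id_comp (F f).l).trans sq.fac_left.symm), ?_⟩
  ext
  · exact Category.comp_id _
  · exact sq.fac_right

/-- A coalgebra structure is a section of the right factor that carries `f` to the unit; following
it by the universal map out of the free cleavage solves any lifting problem. Conversely, the
structure is a lift against the right factor. -/
lemma awfs_leftClass {X Y : C} (f : X ⟶ Y) :
    (awfs F).leftClass f ↔ ∀ {X' Y' : C} (g : X' ⟶ Y'), Nonempty (Cleavage I g) →
      HasLiftingProperty f g := by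
  constructor
  · rintro ⟨s, hs⟩ X' Y' g ⟨ψ⟩
    let s₀ : X ⟶ X := s.left
    let s₁ : Y ⟶ (F f).E := s.right
    have h₁ : s₀ ≫ 𝟙 X = 𝟙 X := congrArg CommaMorphism.left hs
    have h₂ : s₁ ≫ (F f).r = 𝟙 Y := congrArg CommaMorphism.right hs
    have hw : s₀ ≫ (F f).l = f ≫ s₁ := Arrow.w s
    have h₃ : f ≫ s₁ = (F f).l := by
      rw [← hw, ← Category.comp_id s₀, h₁, Category.id_comp]
    refine ⟨fun {u v} sq ↦ ⟨⟨⟨s₁ ≫ (F f).desc ψ u v sq.w, ?_, ?_⟩⟩⟩⟩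
    · rw [reassoc_of% h₃, (F f).l_desc]
    · refine (Category.assoc _ _ _).trans ?_
      rw [((F f).isHom_desc ψ u v sq.w).w, reassoc_of% h₂]
  · intro h
    have := h (F f).r ⟨(F f).cleavage⟩
    exact awfs_leftClass_of_hasLiftingProperty F f

lemma awfs_leftClass_l {X Y : C} (f : X ⟶ Y) : (awfs F).leftClass (F f).l := by
  refine ⟨Arrow.homMk (f := Arrow.mk (F f).l) (g := Arrow.mk (F (F f).l).l) (𝟙 X) (comult F f)
    ((Category.id_comp (F (F f).l).l).trans (l_comult F f).symm), ?_⟩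
  ext
  · exact Category.comp_id _
  · exact comult_r F f

end FreeCleavage

end Cleavages

/-! ### Well-copowered left classes consist of epimorphisms. -/

section Orthogonal

variable {C : Type u} [Category.{v} C]

/-- A class of maps `e : A ⟶ B` closed under forming `A ⟶ B ⊔_A B ⊔_A ⋯` and well-copowered
consists of epimorphisms. -/
lemma IsOrthogonalFactorizationSystem.epi [HasColimits C] {E M : MorphismProperty C}
    (h : IsOrthogonalFactorizationSystem E M) (hE : IsWellCopowered E) {A B : C} (e : A ⟶ B)
    (he : E e) : Epi e := by
  have := h.isWeakFactorizationSystem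
  refine ⟨fun {Z} x y hxy ↦ ?_⟩
  by_contra hne
  obtain ⟨ι, Q, hQ⟩ := hE A
  -- `κ` labels all pairs of an `E`-quotient of `A` and a map from it to `Z`. If `x ≠ y`, then
  -- choosing `x` or `y` on each leg gives `2 ^ κ` distinct maps from the `κ`-fold pushout to `Z`;
  -- as this pushout is itself such a quotient, they inject into `κ`, against Cantor.
  let κ : Type v := Σ i, ((Q i).right ⟶ Z)
  let W := widePushout A (fun _ : κ ↦ B) (fun _ ↦ e)
  let k : A ⟶ W := WidePushout.head _
  have hι (i : κ) : e ≫ WidePushout.ι (fun _ : κ ↦ e) i = k := WidePushout.arrow_ι (fun _ : κ ↦ e) i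
  have hk : E k := by
    rw [← MorphismProperty.llp_eq_of_wfs E M]
    intro S T m hm
    have hl := MorphismProperty.hasLiftingProperty_of_wfs e m he hm
    refine ⟨fun {a b} sq ↦ ?_⟩
    have sq' : ∀ i : κ, CommSq a e m (WidePushout.ι (fun _ : κ ↦ e) i ≫ b) := fun i ↦
      ⟨by rw [sq.w, ← hι i, Category.assoc]⟩
    refine ⟨⟨⟨WidePushout.desc a (fun i ↦ (sq' i).lift) (fun i ↦ (sq' i).fac_left), ?_, ?_⟩⟩⟩
    · exact WidePushout.head_desc _ _ _ _
    · refine WidePushout.hom_ext _ _ _ (fun i ↦ ?_) ?_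
      · rw [WidePushout.ι_desc_assoc, (sq' i).fac_right]
      · rw [WidePushout.head_desc_assoc]
        exact sq.w
  obtain ⟨i, ⟨φ⟩⟩ := hQ (Under.mk k) hk
  classical
  let G : Set κ → κ := fun s ↦ ⟨i, φ.inv.right ≫
    WidePushout.desc (e ≫ x) (fun j ↦ if j ∈ s then x else y)
      (fun j ↦ by split_ifs <;> simp [hxy])⟩
  refine Function.cantor_injective G (fun s t hst ↦ ?_)
  have h₁ := eq_of_heq (Sigma.mk.inj hst).2
  have : IsIso φ.inv.right := inferInstanceAs (IsIso ((Under.forget A).map φ.inv))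
  rw [cancel_epi] at h₁
  ext j
  have h₂ := congrArg (WidePushout.ι (fun _ : κ ↦ e) j ≫ ·) h₁
  simp only [WidePushout.ι_desc] at h₂
  by_cases hs : j ∈ s <;> by_cases ht : j ∈ t <;> simp only [hs, ht, if_true, if_false] at h₂ ⊢
  · exact (hne h₂).elim
  · exact (hne h₂.symm).elim

end Orthogonal

/-! ### Mapping path objects of an abstract cylinder. -/

section PathObjects

variable {C : Type u} [Category.{v} C] (I : Cylinder C)

/-- The evaluation of paths at the start point. -/
def Cylinder.p (Y : C) : I.G.obj Y ⟶ Y := I.i (I.G.obj Y) ≫ I.adj.counit.app Y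

lemma Cylinder.i_homEquiv_symm {Y Z : C} (k : Z ⟶ I.G.obj Y) :
    I.i Z ≫ (I.adj.homEquiv _ _).symm k = k ≫ I.p Y := by
  rw [Adjunction.homEquiv_counit, ← Category.assoc, ← I.i_naturality, Category.assoc, p]

variable [HasPullbacks C]

/-- The mapping path object functor. -/
noncomputable def Cylinder.N (Y : C) : Over Y ⥤ C :=
  Over.pullback (I.p Y) ⋙ Over.forget _

namespace Cylinder

variable {I} {Y : C}

/-- The projection of the mapping path object to the domain. -/
noncomputable def π (B : Over Y) : (I.N Y).obj B ⟶ B.left := pullback.fst B.hom (I.p Y)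

/-- The universal path in the mapping path object. -/
noncomputable def ev (B : Over Y) : I.T.obj ((I.N Y).obj B) ⟶ Y :=
  (I.adj.homEquiv _ _).symm (pullback.snd B.hom (I.p Y))

lemma i_ev (B : Over Y) : I.i _ ≫ ev B = π B ≫ B.hom :=
  (i_homEquiv_symm _ _).trans pullback.condition.symm

/-- The map to the mapping path object induced by a lifting problem. -/
noncomputable def liftN {B : Over Y} {W : C} (a : W ⟶ B.left) (b : I.T.obj W ⟶ Y)
    (h : a ≫ B.hom = I.i W ≫ b) : W ⟶ (I.N Y).obj B :=
  pullback.lift a (I.adj.homEquiv _ _ b) (by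
    rw [← i_homEquiv_symm, Equiv.symm_apply_apply, h])

lemma liftN_π {B : Over Y} {W : C} (a : W ⟶ B.left) (b : I.T.obj W ⟶ Y)
    (h : a ≫ B.hom = I.i W ≫ b) : liftN a b h ≫ π B = a :=
  pullback.lift_fst _ _ _

lemma map_comp_ev {B : Over Y} {W : C} (k : W ⟶ (I.N Y).obj B) :
    I.T.map k ≫ ev B = (I.adj.homEquiv _ _).symm (k ≫ pullback.snd B.hom (I.p Y)) :=
  (Adjunction.homEquiv_naturality_left_symm _ _ _).symm

lemma map_liftN_ev {B : Over Y} {W : C} (a : W ⟶ B.left) (b : I.T.obj W ⟶ Y)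
    (h : a ≫ B.hom = I.i W ≫ b) : I.T.map (liftN a b h) ≫ ev B = b := by
  rw [map_comp_ev, liftN]
  exact (congrArg _ (pullback.lift_snd _ _ _)).trans (Equiv.symm_apply_apply _ _)

/-- The object `N B` represents lifting problems: a map into it is the same as a start in `B`
together with a homotopy in `Y`. -/
lemma N_hom_ext {B : Over Y} {W : C} {k l : W ⟶ (I.N Y).obj B} (h₁ : k ≫ π B = l ≫ π B)
    (h₂ : I.T.map k ≫ ev B = I.T.map l ≫ ev B) : k = l := by
  rw [map_comp_ev, map_comp_ev] at h₂
  exact pullback.hom_ext h₁ ((I.adj.homEquiv _ _).symm.injective h₂)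

lemma N_map_π {B B' : Over Y} (q : B ⟶ B') : (I.N Y).map q ≫ π B' = π B ≫ q.left :=
  pullback.lift_fst _ _ _

lemma map_N_map_ev {B B' : Over Y} (q : B ⟶ B') : I.T.map ((I.N Y).map q) ≫ ev B' = ev B := by
  rw [map_comp_ev]
  refine congrArg (I.adj.homEquiv _ _).symm ((pullback.lift_snd _ _ _).trans ?_)
  rfl

end Cylinder

end PathObjects

/-! ### Partial cleavages, and cleavages as the total ones. -/

section PartialCleavages

variable {C : Type u} [Category.{v} C] (I : Cylinder C)

/-- A map `B ⟶ Y` with chosen lifts for a family of lifting problems parametrized by `W`: the lifts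
are a map `T W ⟶ B`, and they determine the lifting problems. -/
abbrev PartialCleavage (Y : C) := Comma I.T (Over.forget Y)

namespace PartialCleavage

open Cylinder

variable {I} {Y : C}

/-- The family of chosen lifts. -/
def t (d : PartialCleavage I Y) : I.T.obj d.left ⟶ d.right.left := d.hom

lemma map_t {d d' : PartialCleavage I Y} (φ : d ⟶ d') :
    I.T.map φ.left ≫ t d' = t d ≫ φ.right.left := φ.w

/-- A morphism of partial cleavages. -/
def homMk {d d' : PartialCleavage I Y} (l : d.left ⟶ d'.left) (r : d.right ⟶ d'.right)
    (h : I.T.map l ≫ t d' = t d ≫ r.left) : d ⟶ d' where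
  left := l
  right := r
  w := h

instance [HasColimits C] : HasColimits (PartialCleavage I Y) :=
  have := I.adj.leftAdjoint_preservesColimits
  inferInstance

variable [HasPullbacks C]

/-- The family of lifting problems with a chosen solution. -/
noncomputable def w (d : PartialCleavage I Y) : d.left ⟶ (I.N Y).obj d.right :=
  liftN (I.i _ ≫ t d) (t d ≫ d.right.hom) (Category.assoc _ _ _)

lemma w_π (d : PartialCleavage I Y) : w d ≫ π d.right = I.i _ ≫ t d :=
  liftN_π _ _ _

lemma map_w_ev (d : PartialCleavage I Y) : I.T.map (w d) ≫ ev d.right = t d ≫ d.right.hom :=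
  map_liftN_ev _ _ _

lemma w_naturality {d d' : PartialCleavage I Y} (φ : d ⟶ d') :
    φ.left ≫ w d' = w d ≫ (I.N Y).map φ.right := by
  apply N_hom_ext
  · rw [Category.assoc, Category.assoc, w_π, N_map_π, reassoc_of% w_π d, ← map_t φ,
      ← Category.assoc, I.i_naturality, Category.assoc]
  · rw [Functor.map_comp, Functor.map_comp, Category.assoc, Category.assoc, map_w_ev,
      map_N_map_ev, map_w_ev, reassoc_of% map_t φ, Over.w]

variable (I Y) in
/-- The partial cleavages in which every lifting problem has exactly one chosen solution. -/
def isTotal : ObjectProperty (PartialCleavage I Y) := fun d ↦ IsIso (w d)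

/-- The cleavage given by a total partial cleavage. -/
noncomputable def cleavage (d : PartialCleavage I Y) (hd : isTotal I Y d) :
    Cleavage I d.right.hom :=
  have : IsIso (w d) := hd
  { fill a b h := I.T.map (liftN a b h ≫ inv (w d)) ≫ t d
    incl_fill a b h := by
      rw [← Category.assoc, ← I.i_naturality, Category.assoc, ← w_π, Category.assoc,
        IsIso.inv_hom_id_assoc, liftN_π]
    fill_comp a b h := by
      rw [Category.assoc, ← map_w_ev, ← Category.assoc, ← Functor.map_comp, Category.assoc,
        IsIso.inv_hom_id, Category.comp_id, map_liftN_ev]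
    map_fill k a b h := by
      rw [← Category.assoc, ← Functor.map_comp, ← Category.assoc]
      congr 3
      apply N_hom_ext
      · rw [Category.assoc, liftN_π, liftN_π]
      · rw [Functor.map_comp, Category.assoc, map_liftN_ev, map_liftN_ev] }

lemma cleavage_fill (d : PartialCleavage I Y) (hd : isTotal I Y d) {Z : C} (a : Z ⟶ d.right.left)
    (b : I.T.obj Z ⟶ Y) (h : a ≫ d.right.hom = I.i Z ≫ b) (m : Z ⟶ d.left)
    (hm : m ≫ w d = liftN a b h) : (cleavage d hd).fill a b h = I.T.map m ≫ t d := by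
  have : IsIso (w d) := hd
  change I.T.map (liftN a b h ≫ inv (w d)) ≫ t d = _
  rw [← hm, Category.assoc, IsIso.hom_inv_id, Category.comp_id]

lemma t_eq_fill (d : PartialCleavage I Y) (hd : isTotal I Y d) :
    t d = (cleavage d hd).fill (I.i _ ≫ t d) (t d ≫ d.right.hom) (Category.assoc _ _ _) := by
  have : IsIso (w d) := hd
  change _ = I.T.map (w d ≫ inv (w d)) ≫ t d
  rw [IsIso.hom_inv_id, CategoryTheory.Functor.map_id, Category.id_comp]

/-- Naturality of `w`, with both `w` invertible, determines the map on indexing objects from the one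
on underlying objects, so compatibility with `t` becomes compatibility with lifts. -/
lemma isHom_of_hom {d d' : PartialCleavage I Y} (hd : isTotal I Y d) (hd' : isTotal I Y d')
    (φ : d ⟶ d') : (cleavage d hd).IsHom (cleavage d' hd') φ.right.left (𝟙 Y) where
  w := by rw [Over.w, Category.comp_id]
  fill_comp a b h := by
    have : IsIso (w d) := hd
    have : IsIso (w d') := hd'
    change (I.T.map (liftN a b h ≫ inv (w d)) ≫ t d) ≫ _ = I.T.map (liftN _ _ _ ≫ inv (w d')) ≫ t d'
    rw [Category.assoc, ← map_t, ← Category.assoc, ← Functor.map_comp]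
    congr 2
    rw [IsIso.eq_comp_inv, Category.assoc, Category.assoc, w_naturality, IsIso.inv_hom_id_assoc]
    apply N_hom_ext
    · rw [Category.assoc, N_map_π, liftN_π, reassoc_of% liftN_π a b h]
    · rw [Functor.map_comp, Category.assoc, map_N_map_ev, map_liftN_ev, map_liftN_ev,
        Category.comp_id]

/-- The total partial cleavage given by a cleavage. -/
noncomputable def ofCleavage {X : C} {g : X ⟶ Y} (ψ : Cleavage I g) : PartialCleavage I Y where
  left := (I.N Y).obj (Over.mk g)
  right := Over.mk g
  hom := ψ.fill (π (Over.mk g)) (ev (Over.mk g)) (i_ev (Over.mk g)).symm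

lemma w_ofCleavage {X : C} {g : X ⟶ Y} (ψ : Cleavage I g) : w (ofCleavage ψ) = 𝟙 _ := by
  apply N_hom_ext
  · rw [w_π]
    exact (ψ.incl_fill _ _ _).trans (Category.id_comp _).symm
  · rw [map_w_ev]
    refine Eq.trans ?_ (congrArg (· ≫ _) (I.T.map_id _).symm)
    exact (ψ.fill_comp _ _ _).trans (Category.id_comp _).symm

lemma isTotal_ofCleavage {X : C} {g : X ⟶ Y} (ψ : Cleavage I g) :
    isTotal I Y (ofCleavage ψ) := by
  rw [isTotal, w_ofCleavage]
  exact IsIso.id _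

lemma isHom_cleavage_ofCleavage {X : C} {g : X ⟶ Y} (ψ : Cleavage I g) :
    (cleavage (ofCleavage ψ) (isTotal_ofCleavage ψ)).IsHom ψ (𝟙 X) (𝟙 Y) where
  w := (Category.id_comp _).trans (Category.comp_id _).symm
  fill_comp {Z} a b h := by
    let k : Z ⟶ (I.N Y).obj (Over.mk g) := liftN a b h
    refine (Category.comp_id _).trans ?_
    refine (cleavage_fill (ofCleavage ψ) _ a b h k
      ((congrArg (k ≫ ·) (w_ofCleavage ψ)).trans (Category.comp_id _))).trans ?_
    refine (Cleavage.map_fill ψ k _ _ _).trans ?_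
    exact Cleavage.fill_congr _ ((liftN_π a b h).trans (Category.comp_id _).symm)
      ((map_liftN_ev a b h).trans (Category.comp_id _).symm) _

/-- The morphism of partial cleavages given by a morphism of cleavages. -/
noncomputable def homOfIsHom {d : PartialCleavage I Y} (hd : isTotal I Y d) {X : C} {g : X ⟶ Y}
    {ψ : Cleavage I g} {u : d.right.left ⟶ X} (h : (cleavage d hd).IsHom ψ u (𝟙 Y)) :
    d ⟶ ofCleavage ψ :=
  have hu : u ≫ g = d.right.hom := h.w.trans (Category.comp_id _)
  let q : d.right ⟶ Over.mk g := Over.homMk u hu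
  homMk (d' := ofCleavage ψ) (w d ≫ (I.N Y).map q) q (by
      have h₁ : (w d ≫ (I.N Y).map q) ≫ π (Over.mk g) = (I.i _ ≫ t d) ≫ u := by
        rw [Category.assoc, N_map_π, reassoc_of% w_π d, Category.assoc]
        rfl
      have h₂ : I.T.map (w d ≫ (I.N Y).map q) ≫ ev (Over.mk g) = (t d ≫ d.right.hom) ≫ 𝟙 Y := by
        rw [Functor.map_comp, Category.assoc, map_N_map_ev, map_w_ev, Category.comp_id]
      refine (Cleavage.map_fill ψ _ _ _ _).trans ?_
      refine Eq.trans ?_ (congrArg (· ≫ u) (t_eq_fill d hd)).symm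
      rw [h.fill_comp]
      exact Cleavage.fill_congr _ h₁ h₂ _)

/-! ### Freely solving all lifting problems once. -/

section Succ

variable [HasColimits C] (d : PartialCleavage I Y)

/-- The domain of the partial cleavage obtained by freely solving all lifting problems. -/
noncomputable abbrev succObj : C :=
  pushout (coprod.desc (t d) (π d.right)) (coprod.desc (I.T.map (w d)) (I.i _))

lemma t_inl : t d ≫ (pushout.inl _ _ : _ ⟶ succObj d) =
    I.T.map (w d) ≫ (pushout.inr _ _ : _ ⟶ succObj d) := by
  have h := coprod.inl ≫= (pushout.condition (f := coprod.desc (t d) (π d.right))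
    (g := coprod.desc (I.T.map (w d)) (I.i _)))
  rwa [coprod.inl_desc_assoc, coprod.inl_desc_assoc] at h

lemma π_inl : π d.right ≫ (pushout.inl _ _ : _ ⟶ succObj d) =
    I.i _ ≫ (pushout.inr _ _ : _ ⟶ succObj d) := by
  have h := coprod.inr ≫= (pushout.condition (f := coprod.desc (t d) (π d.right))
    (g := coprod.desc (I.T.map (w d)) (I.i _)))
  rwa [coprod.inr_desc_assoc, coprod.inr_desc_assoc] at h

variable {d} in
/-- Maps out of `succObj d`. -/
noncomputable def succDesc {Z : C} (b : d.right.left ⟶ Z)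
    (s : I.T.obj ((I.N Y).obj d.right) ⟶ Z) (h₁ : t d ≫ b = I.T.map (w d) ≫ s)
    (h₂ : π d.right ≫ b = I.i _ ≫ s) : succObj d ⟶ Z :=
  pushout.desc b s (by ext <;> simp [h₁, h₂])

/-- The partial cleavage obtained by freely solving all lifting problems. -/
noncomputable def succ : PartialCleavage I Y where
  left := (I.N Y).obj d.right
  right := Over.mk (succDesc d.right.hom (ev d.right) (map_w_ev d).symm (i_ev _).symm)
  hom := pushout.inr _ _

/-- The canonical morphism `d ⟶ succ d`. -/
noncomputable def toSucc : d ⟶ succ d :=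
  homMk (d' := succ d) (w d) (Over.homMk (V := (succ d).right) (pushout.inl _ _)
    (pushout.inl_desc _ _ _)) (t_inl d).symm

/-- The problems solved in `succ d` are precisely those of `d.right`, viewed in the larger object.
-/
lemma w_succ : w (succ d) = (I.N Y).map (toSucc d).right := by
  apply N_hom_ext
  · exact ((w_π _).trans (π_inl d).symm).trans (N_map_π (toSucc d).right).symm
  · exact ((map_w_ev _).trans (pushout.inr_desc _ _ _)).trans
      (map_N_map_ev (toSucc d).right).symm

/-- A total target `z` already has a unique solution for each problem transported from `d.right`. So
the indexing part of an extension must be `N` of the given map followed by the inverse of `w z`, and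
the pushout supplies the rest. -/
lemma isLocal_toSucc : (isTotal I Y).isLocal (toSucc d) := by
  intro z hz
  have : IsIso (w z) := hz
  constructor
  · intro g g' h
    have hr : (toSucc d).right ≫ g.right = (toSucc d).right ≫ g'.right :=
      congrArg CommaMorphism.right h
    have hl : g.left = g'.left := by
      rw [← cancel_mono (w z), w_naturality, w_naturality, w_succ]
      exact ((I.N Y).map_comp _ _).symm.trans ((congrArg _ hr).trans ((I.N Y).map_comp _ _))
    have hr' : g.right.left = g'.right.left := by
      refine pushout.hom_ext ?_ ?_
      · exact congrArg CommaMorphism.left hr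
      · refine (map_t g).symm.trans (Eq.trans ?_ (map_t g'))
        rw [hl]
    ext
    · exact hl
    · exact hr'
  · intro h
    have hl : w d ≫ (I.N Y).map h.right ≫ inv (w z) = h.left := by
      rw [← Category.assoc, ← w_naturality, Category.assoc, IsIso.hom_inv_id, Category.comp_id]
    have h₁ : t d ≫ h.right.left =
        I.T.map (w d) ≫ I.T.map ((I.N Y).map h.right ≫ inv (w z)) ≫ t z := by
      rw [← Category.assoc, ← Functor.map_comp, hl, map_t]
    have h₂ : π d.right ≫ h.right.left =
        I.i _ ≫ I.T.map ((I.N Y).map h.right ≫ inv (w z)) ≫ t z := by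
      rw [← Category.assoc, ← I.i_naturality, Category.assoc, ← w_π, Category.assoc,
        IsIso.inv_hom_id_assoc, N_map_π]
    refine ⟨homMk (d := succ d) ((I.N Y).map h.right ≫ inv (w z))
      (Over.homMk (U := (succ d).right) (succDesc h.right.left _ h₁ h₂) ?_) ?_, ?_⟩
    · refine pushout.hom_ext ?_ ?_
      · refine (pushout.inl_desc_assoc _ _ _ _).trans (Eq.trans ?_ (pushout.inl_desc _ _ _).symm)
        rw [Over.w]
      · refine (pushout.inr_desc_assoc _ _ _ _).trans (Eq.trans ?_ (pushout.inr_desc _ _ _).symm)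
        rw [Category.assoc, ← map_w_ev, ← Category.assoc, ← Functor.map_comp, Category.assoc,
          IsIso.inv_hom_id, Category.comp_id, map_N_map_ev]
    · exact (pushout.inr_desc _ _ _).symm
    · ext
      · exact hl
      · exact pushout.inl_desc _ _ _

end Succ

end PartialCleavage

end PartialCleavages

/-! ### Stabilization and the transfinite sequence. -/

namespace PartialCleavage

open Cylinder

variable {C : Type u} [Category.{v} C] {I : Cylinder C} {Y : C} [HasPullbacks C]

/-- A morphism `φ : d ⟶ d'` such that passing from `d'` to a larger partial cleavage does not
enlarge the kernel of the map of underlying objects, as measured by the class `E`. -/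
def IsStable (E : MorphismProperty C) {d d' : PartialCleavage I Y} (φ : d ⟶ d') : Prop :=
  ∀ {d'' : PartialCleavage I Y} (ψ : d' ⟶ d''), (isTotal I Y).isLocal ψ →
    ∀ {A : C} (e : d.right.left ⟶ A) (m : A ⟶ d''.right.left), E e →
      e ≫ m = φ.right.left ≫ ψ.right.left → ∃ σ : A ⟶ d'.right.left, e ≫ σ = φ.right.left

variable [HasColimits C]

lemma isLocal_head (d : PartialCleavage I Y) {ι : Type v} (D : ι → PartialCleavage I Y)
    (φ : ∀ i, d ⟶ D i) (hφ : ∀ i, (isTotal I Y).isLocal (φ i)) :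
    (isTotal I Y).isLocal (WidePushout.head φ) := by
  intro z hz
  constructor
  · intro g g' h
    refine WidePushout.hom_ext _ _ _ (fun i ↦ (hφ i z hz).1 ?_) h
    simpa only [← Category.assoc, WidePushout.arrow_ι] using h
  · intro h
    choose k hk using fun i ↦ (hφ i z hz).2 h
    exact ⟨WidePushout.desc h k hk, WidePushout.head_desc _ _ _ _⟩

/-- For each of the set-many `E`-quotients through which some local enlargement of `d` factors,
choose one such enlargement; then amalgamate the choices under `d`. A quotient that appears after
any further local enlargement has then already been realized. -/
lemma exists_isStable {E : MorphismProperty C} (hE : IsWellCopowered E)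
    (d : PartialCleavage I Y) :
    ∃ (d' : PartialCleavage I Y) (φ : d ⟶ d'), (isTotal I Y).isLocal φ ∧ IsStable E φ := by
  obtain ⟨ι, Q, hQ⟩ := hE d.right.left
  let S (i : ι) : Prop := ∃ (d' : PartialCleavage I Y) (φ : d ⟶ d'), (isTotal I Y).isLocal φ ∧
    ∃ (A : C) (e : d.right.left ⟶ A) (m : A ⟶ d'.right.left), e ≫ m = φ.right.left ∧
      Nonempty (Under.mk e ≅ Q i)
  have h (i : ι) : ∃ (d' : PartialCleavage I Y) (φ : d ⟶ d'), (isTotal I Y).isLocal φ ∧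
      (S i → ∃ (A : C) (e : d.right.left ⟶ A) (m : A ⟶ d'.right.left), e ≫ m = φ.right.left ∧
        Nonempty (Under.mk e ≅ Q i)) := by
    by_cases hi : S i
    · obtain ⟨d', φ, hφ, h⟩ := hi
      exact ⟨d', φ, hφ, fun _ ↦ h⟩
    · exact ⟨d, 𝟙 d, (isTotal I Y).isLocal.id_mem d, fun h ↦ (hi h).elim⟩
  choose D φ hφ h using h
  have hloc := isLocal_head d D φ hφ
  refine ⟨widePushout d D φ, WidePushout.head φ, hloc, ?_⟩
  intro d'' ψ hψ A e m he hm
  obtain ⟨i, ⟨k⟩⟩ := hQ (Under.mk e) he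
  obtain ⟨A', e', m', hm', ⟨k'⟩⟩ := h i ⟨d'', WidePushout.head φ ≫ ψ,
    (isTotal I Y).isLocal.comp_mem _ _ hloc hψ, A, e, m, hm, ⟨k⟩⟩
  let q : Under.mk e ⟶ Under.mk e' := k.hom ≫ k'.inv
  have hq : e ≫ q.right = e' := Under.w q
  refine ⟨q.right ≫ m' ≫ (WidePushout.ι φ i).right.left, ?_⟩
  rw [reassoc_of% hq, reassoc_of% hm', ← WidePushout.arrow_ι φ i]
  rfl

/-- Each step stabilizes and then solves all problems once; the index `k` is the successor of `j`,
expressed by minimality. -/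
lemma exists_chain {E : MorphismProperty C} (hE : IsWellCopowered E) (d₀ : PartialCleavage I Y)
    (α : Cardinal.{v}) (hα : α.IsRegular) :
    ∃ (F : α.ord.ToType ⥤ PartialCleavage I Y) (c : Cocone F) (_ : IsColimit c) (q : d₀ ⟶ c.pt),
      (isTotal I Y).isLocal q ∧ (∀ j, (isTotal I Y).isLocal (c.ι.app j)) ∧
      ∀ j, ∃ (k : α.ord.ToType) (hjk : j < k) (d : PartialCleavage I Y) (φ : F.obj j ⟶ d)
        (ψ : succ d ⟶ F.obj k), (∀ l, j < l → k ≤ l) ∧ (isTotal I Y).isLocal φ ∧ IsStable E φ ∧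
          F.map (homOfLE hjk.le) = φ ≫ toSucc d ≫ ψ := by
  have := Cardinal.noMaxOrder hα.aleph0_le
  have : Nonempty α.ord.ToType := by
    rw [Ordinal.nonempty_toType_iff]
    exact hα.ord_pos.ne'
  let _ : OrderBot α.ord.ToType := WellFoundedLT.toOrderBot _
  let _ : SuccOrder α.ord.ToType := SuccOrder.ofLinearWellFoundedLT _
  choose D φ hφ hφ' using fun d : PartialCleavage I Y ↦ exists_isStable hE d
  let Φ : SmallObject.SuccStruct (PartialCleavage I Y) :=
    { X₀ := d₀
      succ d := succ (D d)
      toSucc d := φ d ≫ toSucc (D d) }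
  -- Locality is stable under transfinite composition, so it passes from the steps to the whole
  -- composite and to every leg of the cocone.
  let H : (isTotal I Y).isLocal.TransfiniteCompositionOfShape α.ord.ToType
      (Φ.ιIteration α.ord.ToType) :=
    (Φ.transfiniteCompositionOfShapeιIteration α.ord.ToType).ofLE (by
      rintro d _ _ ⟨_⟩
      exact MorphismProperty.comp_mem _ _ _ (hφ d) (isLocal_toSucc _))
  refine ⟨Φ.iterationFunctor _, Φ.iterationCocone _, Φ.isColimitIterationCocone _,
    Φ.ιIteration _,
    (isTotal I Y).isLocal.transfiniteCompositionsOfShape_le α.ord.ToType _ ⟨H⟩, fun j ↦ H.mem_incl_app j, fun j ↦ ⟨Order.succ j,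
      Order.lt_succ j, D _, φ _, (Φ.iterationFunctorObjSuccIso j (not_isMax j)).inv,
      fun l hl ↦ Order.succ_le_of_lt hl, hφ _, hφ' _, ?_⟩⟩
  rw [Φ.iterationFunctor_map_succ j (not_isMax j)]
  exact Category.assoc _ _ _

/-! ### Convergence of the sequence. -/

section Convergence

variable {E M : MorphismProperty C} {α : Cardinal.{v}} {F : α.ord.ToType ⥤ PartialCleavage I Y}
  {c : Cocone F}

omit [HasPullbacks C] in
/-- The `(E, M)`-factorizations of the legs of a cocone form a sequence with the same colimit. -/
lemma exists_images (hEM : IsOrthogonalFactorizationSystem E M) (hE : IsWellCopowered E)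
    (hc : IsColimit c) :
    ∃ (Q : α.ord.ToType ⥤ Over Y) (p : Q ⟶ (Functor.const _).obj c.pt.right)
      (e : ∀ j, (F.obj j).right ⟶ Q.obj j),
      Nonempty (IsColimit ((Over.forget Y).mapCocone (Cocone.mk _ p))) ∧
      (∀ j, M (p.app j).left) ∧ (∀ j, E (e j).left) ∧
      (∀ j, e j ≫ p.app j = (c.ι.app j).right) ∧
      ∀ j k (h : j ⟶ k), e j ≫ Q.map h = (F.map h).right ≫ e k := by
  have := hEM.isWeakFactorizationSystem
  have hepi {A B : C} (e : A ⟶ B) (he : E e) : Epi e := hEM.epi hE e he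
  have := I.adj.leftAdjoint_preservesColimits
  have hB : IsColimit ((Comma.snd _ _ ⋙ Over.forget Y).mapCocone c) :=
    isColimitOfPreserves (Comma.snd I.T (Over.forget Y) ⋙ Over.forget Y) hc
  -- The images of the legs. Since their `E`-parts are epimorphisms, the lifts between successive
  -- images are functorial.
  let m (j) := MorphismProperty.factorizationData E M (c.ι.app j).right.left
  have hm (j) : Epi (m j).i := hepi _ (m j).hi
  have sq {j k} (h : j ⟶ k) :
      CommSq ((F.map h).right.left ≫ (m k).i) (m j).i (m k).p (m j).p := ⟨by
    rw [Category.assoc, (m k).fac, (m j).fac, ← c.w h]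
    rfl⟩
  have hl {j k} (h : j ⟶ k) : HasLiftingProperty (m j).i (m k).p :=
    MorphismProperty.hasLiftingProperty_of_wfs _ _ (m j).hi (m k).hp
  let l {j k} (h : j ⟶ k) : (m j).Z ⟶ (m k).Z := have := hl h; (sq h).lift
  have hl₁ {j k} (h : j ⟶ k) : (m j).i ≫ l h = (F.map h).right.left ≫ (m k).i :=
    have := hl h; (sq h).fac_left
  have hl₂ {j k} (h : j ⟶ k) : l h ≫ (m k).p = (m j).p :=
    have := hl h; (sq h).fac_right
  let Q : α.ord.ToType ⥤ Over Y :=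
    { obj j := Over.mk ((m j).p ≫ c.pt.right.hom)
      map {j k} h := Over.homMk (l h) (by
        change l h ≫ (m k).p ≫ _ = _
        rw [reassoc_of% hl₂ h]
        rfl)
      map_id j := by
        ext
        change l (𝟙 j) = 𝟙 _
        rw [← cancel_epi (m j).i, hl₁, F.map_id]
        exact (Category.id_comp _).trans (Category.comp_id _).symm
      map_comp {j k n} h h' := by
        ext
        change l (h ≫ h') = l h ≫ l h'
        rw [← cancel_epi (m j).i, hl₁, reassoc_of% hl₁ h, hl₁, F.map_comp]
        exact Category.assoc _ _ _ }
  let p : Q ⟶ (Functor.const _).obj c.pt.right :=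
    { app j := Over.homMk (U := Q.obj j) (m j).p rfl
      naturality j k h := by
        ext
        exact (hl₂ h).trans (Category.comp_id _).symm }
  let e (j) : (F.obj j).right ⟶ Q.obj j := Over.homMk (V := Q.obj j) (m j).i (by
    change (m j).i ≫ (m j).p ≫ _ = _
    rw [(m j).fac_assoc]
    exact Over.w (c.ι.app j).right)
  have hp (j) : e j ≫ p.app j = (c.ι.app j).right := by
    ext
    exact (m j).fac
  have he {j k} (h : j ⟶ k) : e j ≫ Q.map h = (F.map h).right ≫ e k := by
    ext
    exact hl₁ h
  refine ⟨Q, p, e, ⟨?_⟩, fun j ↦ (m j).hp, fun j ↦ (m j).hi, hp, fun j k h ↦ he h⟩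
  -- A cocone on the images restricts to one on `F`. The induced map has the right values on images
  -- after cancelling the epimorphisms.
  let s' (s : Cocone (Q ⋙ Over.forget Y)) : Cocone (F ⋙ Comma.snd _ _ ⋙ Over.forget Y) :=
    { pt := s.pt
      ι :=
        { app j := (m j).i ≫ s.ι.app j
          naturality j k h := by
            refine (Category.assoc _ _ _).symm.trans (Eq.trans ?_ (Category.comp_id _).symm)
            refine (congrArg (· ≫ s.ι.app k) (hl₁ h).symm).trans ?_
            refine (Category.assoc _ _ _).trans ?_
            exact congrArg ((m j).i ≫ ·) (s.w h) } }
  exact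
    { desc s := hB.desc (s' s)
      fac s j := by
        refine (cancel_epi (m j).i).1 ?_
        refine Eq.trans ?_ (hB.fac (s' s) j)
        refine (Category.assoc _ _ _).symm.trans ?_
        exact congrArg (· ≫ hB.desc (s' s)) (m j).fac
      uniq s g hg := by
        refine hB.hom_ext (fun j ↦ ?_)
        refine Eq.trans ?_ (hB.fac (s' s) j).symm
        refine Eq.trans ?_ (congrArg ((m j).i ≫ ·) (hg j))
        refine Eq.trans ?_ (Category.assoc _ _ _)
        exact congrArg (· ≫ g) (m j).fac.symm }

/-- The colimit of a sequence of partial cleavages in which every step is stable and solves all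
lifting problems is total, if the mapping path object functor preserves the colimits of sequences
with legs in `M`. -/
lemma isTotal_of_isColimit (hEM : IsOrthogonalFactorizationSystem E M) (hE : IsWellCopowered E)
    (hN : ∀ (f : α.ord.ToType ⥤ Over Y) (c : Cocone f),
      Nonempty (IsColimit ((Over.forget Y).mapCocone c)) → (∀ β, M (c.ι.app β).left) →
        Nonempty (IsColimit ((I.N Y).mapCocone c)))
    (hc : IsColimit c) (hloc : ∀ j, (isTotal I Y).isLocal (c.ι.app j))
    (hF : ∀ j, ∃ (k : α.ord.ToType) (hjk : j < k) (d : PartialCleavage I Y) (φ : F.obj j ⟶ d)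
        (ψ : succ d ⟶ F.obj k), (∀ l, j < l → k ≤ l) ∧ (isTotal I Y).isLocal φ ∧ IsStable E φ ∧
          F.map (homOfLE hjk.le) = φ ≫ toSucc d ≫ ψ) :
    isTotal I Y c.pt := by
  have hepi {A B : C} (e : A ⟶ B) (he : E e) : Epi e := hEM.epi hE e he
  have := I.adj.leftAdjoint_preservesColimits
  have hW : IsColimit ((Comma.fst I.T (Over.forget Y)).mapCocone c) :=
    isColimitOfPreserves _ hc
  obtain ⟨Q, p, e, hQ, hM, he, hep, heQ⟩ := exists_images hEM hE hc
  obtain ⟨hNQ⟩ := hN Q _ hQ hM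
  choose k hk D φ ψ hmin hφ hst hfac using hF
  have hepi' (j) : Epi (e j) := (Over.forget Y).epi_of_epi_map (hepi _ (he j))
  let b (j) : F.obj j ⟶ c.pt := c.ι.app j
  have hb {j l} (h : j ⟶ l) : F.map h ≫ b l = b j := c.w h
  change ∀ j, (isTotal I Y).isLocal (b j) at hloc
  let p' (j) : Q.obj j ⟶ c.pt.right := p.app j
  change ∀ j, e j ≫ p' j = (b j).right at hep
  let ψ' (j) : succ (D j) ⟶ c.pt := ψ j ≫ b (k j)
  have hψ (j) : φ j ≫ toSucc (D j) ≫ ψ' j = b j := by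
    rw [← hb (homOfLE (hk j).le), hfac j]
    simp only [ψ', Category.assoc]
  -- Stability of `φ j` is tested on local enlargements of `D j`, so `c.pt` must be one: cancel the
  -- local `φ j` from the local leg `b j`.
  have hψloc (j) : (isTotal I Y).isLocal (toSucc (D j) ≫ ψ' j) := by
    refine MorphismProperty.of_precomp _ (φ j) _ (hφ j) ?_
    rw [hψ]
    exact hloc j
  -- By stability the image of `F j` in the colimit already maps to `D j`; the map lies over `Y`
  -- because the `E`-part is epi.
  have hσ (j) : ∃ σ : Q.obj j ⟶ (D j).right, e j ≫ σ = (φ j).right := by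
    obtain ⟨σ, h⟩ := hst j _ (hψloc j) (e j).left (p' j).left (he j) (by
      have := congrArg (fun x ↦ CommaMorphism.left (CommaMorphism.right x)) (hψ j)
      exact (congrArg CommaMorphism.left (hep j)).trans this.symm)
    have := hepi _ (he j)
    refine ⟨Over.homMk σ ?_, by ext; exact h⟩
    rw [← cancel_epi (e j).left, reassoc_of% h, Over.w, Over.w]
  choose σ hσ using hσ
  have hσp (j) : σ j ≫ (toSucc (D j)).right ≫ (ψ' j).right = p' j := by
    rw [← cancel_epi (e j), reassoc_of% hσ j, hep, ← hψ]
    rfl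
  let ψl (j) : (I.N Y).obj (D j).right ⟶ c.pt.left := (ψ' j).left
  have hψw (j) : ψl j ≫ w c.pt =
      (I.N Y).map (toSucc (D j)).right ≫ (I.N Y).map (ψ' j).right := by
    rw [← w_succ]
    exact w_naturality (ψ' j)
  have hψl (j) : (φ j).left ≫ w (D j) ≫ ψl j = (b j).left :=
    congrArg CommaMorphism.left (hψ j)
  -- The inverse of `w c.pt`, on one image: move a lifting problem in `Q j` to `D j` along `σ j`,
  -- where the next stage indexes a solution of it.
  let κ (j) : (I.N Y).obj (Q.obj j) ⟶ c.pt.left := (I.N Y).map (σ j) ≫ ψl j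
  have hκ {j l} (h : j ⟶ l) : (I.N Y).map (Q.map h) ≫ κ l = κ j := by
    obtain rfl | hjl := (leOfHom h).eq_or_lt
    · obtain rfl : h = 𝟙 j := Subsingleton.elim _ _
      rw [Q.map_id, CategoryTheory.Functor.map_id, Category.id_comp]
    -- For `j < l` the solutions adjoined at stage `j` are already present in `D l`. Naturality of
    -- `w` along `χ` shows that solving them again at stage `l` gives the same result in the
    -- colimit.
    · let χ : succ (D j) ⟶ D l := ψ j ≫ F.map (homOfLE (hmin j l hjl)) ≫ φ l
      have hχ : χ ≫ toSucc (D l) ≫ ψ' l = ψ' j := by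
        simp only [χ, Category.assoc]
        rw [hψ, hb]
      have hQσ : Q.map h ≫ σ l = σ j ≫ (toSucc (D j)).right ≫ χ.right := by
        rw [← cancel_epi (e j), ← Category.assoc, heQ, Category.assoc, hσ, reassoc_of% hσ j]
        have h₁ : F.map h ≫ φ l = φ j ≫ toSucc (D j) ≫ χ := by
          obtain rfl : h = homOfLE (hk j).le ≫ homOfLE (hmin j l hjl) := Subsingleton.elim _ _
          rw [F.map_comp, hfac j]
          simp only [χ, Category.assoc]
        exact congrArg CommaMorphism.right h₁
      have h₂ : (I.N Y).map (toSucc (D j)).right ≫ (I.N Y).map χ.right ≫ ψl l = ψl j := by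
        have h₃ : (I.N Y).map (toSucc (D j)).right ≫ (I.N Y).map χ.right =
            χ.left ≫ w (D l) := by
          rw [← w_succ]
          exact (w_naturality χ).symm
        rw [← Category.assoc, h₃]
        exact (Category.assoc _ _ _).trans (congrArg CommaMorphism.left hχ)
      refine (Category.assoc _ _ _).symm.trans ?_
      rw [← Functor.map_comp, hQσ, Functor.map_comp, Functor.map_comp, Category.assoc,
        Category.assoc, h₂]
  -- This is where preservation of the colimit of images by `N` is used.
  let v : (I.N Y).obj c.pt.right ⟶ c.pt.left := hNQ.desc
    { pt := c.pt.left
      ι := { app := κ, naturality _ _ h := (hκ h).trans (Category.comp_id _).symm } }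
  have hv (j) : (I.N Y).map (p' j) ≫ v = κ j := hNQ.fac _ j
  refine ⟨v, ?_, ?_⟩
  · refine hW.hom_ext (fun j ↦ ?_)
    change (b j).left ≫ w c.pt ≫ v = (b j).left ≫ 𝟙 _
    rw [← Category.assoc, w_naturality, ← hep, Functor.map_comp, Category.assoc, Category.assoc,
      hv, Category.comp_id]
    dsimp only [κ]
    rw [← Category.assoc ((I.N Y).map _), ← Functor.map_comp, hσ, ← Category.assoc,
      ← w_naturality, Category.assoc, hψl]
  · refine hNQ.hom_ext (fun j ↦ ?_)
    change (I.N Y).map (p' j) ≫ v ≫ w c.pt = (I.N Y).map (p' j) ≫ 𝟙 _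
    rw [← Category.assoc, hv, Category.comp_id, ← hσp]
    dsimp only [κ]
    rw [Category.assoc, hψw]
    simp only [Functor.map_comp]

end Convergence

end PartialCleavage

/-! ### Existence of free cleavages, and lifting against all inclusions. -/

open PartialCleavage in
/-- Free cleavages exist if the mapping path object functor preserves the colimits of sequences
with legs in `M`. -/
lemma nonempty_freeCleavage {C : Type u} [Category.{v} C] [HasPullbacks C] [HasColimits C]
    (I : Cylinder C) {E M : MorphismProperty C} (hEM : IsOrthogonalFactorizationSystem E M)
    (hE : IsWellCopowered E) {α : Cardinal.{v}} (hα : α.IsRegular)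
    {X Y : C} (hN : ∀ (f : α.ord.ToType ⥤ Over Y) (c : Cocone f),
      Nonempty (IsColimit ((Over.forget Y).mapCocone c)) → (∀ β, M (c.ι.app β).left) →
        Nonempty (IsColimit ((I.N Y).mapCocone c)))
    (f : X ⟶ Y) : Nonempty (FreeCleavage I f) := by
  have := I.adj.leftAdjoint_preservesColimits
  have h₀ : IsInitial (I.T.obj (⊥_ C)) := initialIsInitial.isInitialObj I.T
  -- No lifts are prescribed, since `I.T` preserves the initial object. The reflection of `d₀` into
  -- total partial cleavages is the free cleavage on `f`.
  let d₀ : PartialCleavage I Y :=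
    { left := ⊥_ C
      right := Over.mk f
      hom := h₀.to _ }
  obtain ⟨F, c, hc, q, hq, hloc, hF⟩ := exists_chain hE d₀ α hα
  have hz := isTotal_of_isColimit hEM hE hN hc hloc hF
  generalize c.pt = z at hz q hq
  -- Locality only concerns objects over the fixed `Y`, so a general target is first pulled back
  -- along `v`.
  have hex {X' Y' : C} {g : X' ⟶ Y'} (ψ : Cleavage I g) (u : X ⟶ X') (v : Y ⟶ Y')
      (w : u ≫ g = f ≫ v) : ∃ e : z.right.left ⟶ X', q.right.left ≫ e = u ∧
        (cleavage z hz).IsHom ψ e v := by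
    let ψ' := ψ.pullback v
    obtain ⟨k, hk⟩ := (hq (ofCleavage ψ') (isTotal_ofCleavage ψ')).2
      (homMk (d := d₀) (initial.to _) (Over.homMk (U := Over.mk f) (V := Over.mk _)
        (pullback.lift u f w) (pullback.lift_snd _ _ _)) (h₀.hom_ext _ _))
    have hk' : q.right.left ≫ k.right.left = pullback.lift u f w :=
      congrArg (fun x ↦ CommaMorphism.left (CommaMorphism.right x)) hk
    refine ⟨k.right.left ≫ pullback.fst g v, ?_, ?_⟩
    · refine (Category.assoc _ _ _).symm.trans ?_
      exact (congrArg (· ≫ pullback.fst g v) hk').trans (pullback.lift_fst _ _ _)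
    · exact (((isHom_of_hom hz (isTotal_ofCleavage ψ') k).comp
        (isHom_cleavage_ofCleavage ψ')).comp (ψ.isHom_pullback_fst v)).of_eq
          (congrArg (· ≫ pullback.fst g v) (Category.comp_id _)) (by simp)
  choose e he he' using @hex
  exact ⟨{
    E := z.right.left
    l := q.right.left
    r := z.right.hom
    fac := Over.w q.right
    cleavage := cleavage z hz
    desc ψ u v w := e ψ u v w
    l_desc ψ u v w := he ψ u v w
    isHom_desc ψ u v w := he' ψ u v w
    hom_ext {X' Y' g} ψ v e e' h h' hl := by
      let ψ' := ψ.pullback v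
      have hk : homOfIsHom hz h.pullback_lift = homOfIsHom hz h'.pullback_lift := by
        refine (hq (ofCleavage ψ') (isTotal_ofCleavage ψ')).1 ?_
        have h₁ : q.right.left ≫ pullback.lift e z.right.hom h.w =
            q.right.left ≫ pullback.lift e' z.right.hom h'.w := by
          ext
          · rw [Category.assoc, Category.assoc, pullback.lift_fst, pullback.lift_fst, hl]
          · rw [Category.assoc, Category.assoc, pullback.lift_snd, pullback.lift_snd]
        ext
        exact h₁
      have hk' : pullback.lift e z.right.hom h.w = pullback.lift e' z.right.hom h'.w :=
        congrArg (fun x ↦ CommaMorphism.left (CommaMorphism.right x)) hk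
      rw [← pullback.lift_fst e z.right.hom h.w, hk', pullback.lift_fst] }⟩

/-- One lift of the universal problem on `N f` suffices: every other problem is its restriction
along a unique map, which makes the resulting lifts natural. -/
lemma nonempty_cleavage_iff {C : Type u} [Category.{v} C] [HasPullbacks C] (I : Cylinder C)
    {X Y : C} (f : X ⟶ Y) :
    Nonempty (Cleavage I f) ↔ ∀ Z, HasLiftingProperty (I.i Z) f := by
  constructor
  · rintro ⟨φ⟩ Z
    exact ⟨fun {a b} sq ↦ ⟨⟨⟨φ.fill a b sq.w, φ.incl_fill _ _ _, φ.fill_comp _ _ _⟩⟩⟩⟩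
  · intro h
    let B : Over Y := Over.mk f
    have := h ((I.N Y).obj B)
    have sq : CommSq (Cylinder.π B) (I.i _) f (Cylinder.ev B) := ⟨(Cylinder.i_ev B).symm⟩
    exact ⟨{
      fill a b h := I.T.map (Cylinder.liftN (B := B) a b h) ≫ sq.lift
      incl_fill a b h := by
        rw [← Category.assoc, ← I.i_naturality, Category.assoc, sq.fac_left, Cylinder.liftN_π]
      fill_comp a b h := by
        rw [Category.assoc, sq.fac_right, Cylinder.map_liftN_ev]
      map_fill k a b h := by
        rw [← Category.assoc, ← Functor.map_comp]
        congr 2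
        apply Cylinder.N_hom_ext
        · rw [Category.assoc, Cylinder.liftN_π, Cylinder.liftN_π]
        · rw [Functor.map_comp, Category.assoc, Cylinder.map_liftN_ev, Cylinder.map_liftN_ev] }⟩

/-! ### Enriched tensors and cotensors on underlying hom-sets. -/

section Enriched

variable {V : Type*} [Category* V] [MonoidalCategory V] {C : Type*} [Category* C]
  [EnrichedOrdinaryCategory V C]

lemma eHomEquiv_comp_eq_whiskerLeft {X Y Z : C} (f : X ⟶ Y) (g : Y ⟶ Z) :
    eHomEquiv V (f ≫ g) = eHomEquiv V f ≫ eHomWhiskerLeft V X g := by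
  rw [eHomEquiv_comp, eHomWhiskerLeft, rightUnitor_inv_naturality_assoc, MonoidalCategory.tensorHom_def,
    Category.assoc, unitors_inv_equal]

lemma eHomEquiv_comp_eq_whiskerRight {X Y Z : C} (f : X ⟶ Y) (g : Y ⟶ Z) :
    eHomEquiv V (f ≫ g) = eHomEquiv V g ≫ eHomWhiskerRight V f Z := by
  rw [eHomEquiv_comp, eHomWhiskerRight, leftUnitor_inv_naturality_assoc, MonoidalCategory.tensorHom_def',
    Category.assoc]

lemma comp_eHomWhiskerLeft {X Y Z : C} {K : V} (k : K ⟶ (X ⟶[V] Y)) (g : Y ⟶ Z) :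
    k ≫ eHomWhiskerLeft V X g = (ρ_ K).inv ≫ (k ⊗ₘ eHomEquiv V g) ≫ eComp V X Y Z := by
  rw [eHomWhiskerLeft, rightUnitor_inv_naturality_assoc, MonoidalCategory.tensorHom_def, Category.assoc]

lemma comp_eHomWhiskerRight {X Y Z : C} {K : V} (k : K ⟶ (Y ⟶[V] Z)) (f : X ⟶ Y) :
    k ≫ eHomWhiskerRight V f Z = (λ_ K).inv ≫ (eHomEquiv V f ⊗ₘ k) ≫ eComp V X Y Z := by
  rw [eHomWhiskerRight, leftUnitor_inv_naturality_assoc, MonoidalCategory.tensorHom_def', Category.assoc]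

/-- Maps out of a tensor. -/
noncomputable def Tensor.homEquiv {X : C} {K : V} (T : Tensor V X K) (Y : C) :
    (T.obj ⟶ Y) ≃ (K ⟶ (X ⟶[V] Y)) :=
  Equiv.ofBijective (fun h ↦ T.coev ≫ eHomWhiskerLeft V X h) (by
    -- Universality at the monoidal unit, where maps into the hom-object are ordinary morphisms.
    have h := ((T.bijective (𝟙_ V) Y).comp (eHomEquiv V).bijective)
    have h' := ((ρ_ K).homFromEquiv (Z := (X ⟶[V] Y))).bijective.comp h
    convert h' using 2 with k
    exact comp_eHomWhiskerLeft _ _)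

/-- Maps into a cotensor. -/
noncomputable def Cotensor.homEquiv {Y : C} {K : V} (T : Cotensor V Y K) (X : C) :
    (X ⟶ T.obj) ≃ (K ⟶ (X ⟶[V] Y)) :=
  Equiv.ofBijective (fun h ↦ T.ev ≫ eHomWhiskerRight V h Y) (by
    have h := ((T.bijective (𝟙_ V) X).comp (eHomEquiv V).bijective)
    have h' := ((λ_ K).homFromEquiv (Z := (X ⟶[V] Y))).bijective.comp h
    convert h' using 2 with k
    exact comp_eHomWhiskerRight _ _)

lemma Tensor.homEquiv_apply {X : C} {K : V} (T : Tensor V X K) {Y : C} (h : T.obj ⟶ Y) :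
    T.homEquiv Y h = T.coev ≫ eHomWhiskerLeft V X h := rfl

lemma Cotensor.homEquiv_apply {Y : C} {K : V} (T : Cotensor V Y K) {X : C} (h : X ⟶ T.obj) :
    T.homEquiv X h = T.ev ≫ eHomWhiskerRight V h Y := rfl

lemma Tensor.homEquiv_comp {X : C} {K : V} (T : Tensor V X K) {Y Z : C} (h : T.obj ⟶ Y)
    (g : Y ⟶ Z) : T.homEquiv Z (h ≫ g) = T.homEquiv Y h ≫ eHomWhiskerLeft V X g := by
  simp [homEquiv_apply]

lemma Cotensor.homEquiv_comp {Y : C} {K : V} (T : Cotensor V Y K) {X Z : C} (g : Z ⟶ X)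
    (h : X ⟶ T.obj) : T.homEquiv Z (g ≫ h) = T.homEquiv X h ≫ eHomWhiskerRight V g Y := by
  simp [homEquiv_apply]

end Enriched

/-! ### Reparametrization and concatenation of paths. -/

section Interval

open CartesianMonoidalCategory

variable (P : ObjectProperty TopCat.{v}) [CartesianMonoidalCategory P.FullSubcategory]
  [IsConvenient P]

/-- A reparametrization of the unit interval. -/
def intervalMap (φ : C(unitInterval, unitInterval)) : interval P ⟶ interval P :=
  ObjectProperty.homMk (TopCat.ofHom ⟨fun x ↦ ULift.up (φ x.down), by fun_prop⟩)

/-- A reparametrization of the unit square. -/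
def squareMap (φ : C(unitInterval × unitInterval, unitInterval)) :
    interval P ⊗ interval P ⟶ interval P :=
  -- Only continuity of the two projections is used, so the chosen product need not be identified
  -- with the topological product.
  ObjectProperty.homMk (TopCat.ofHom ⟨fun x ↦ ULift.up
    (φ (ULift.down ((fst (interval P) (interval P)).hom.hom x),
      ULift.down ((snd (interval P) (interval P)).hom.hom x))),
    continuous_uliftUp.comp (φ.continuous.comp
      ((continuous_uliftDown.comp (fst (interval P) (interval P)).hom.hom.continuous).prodMk
      (continuous_uliftDown.comp (snd (interval P) (interval P)).hom.hom.continuous)))⟩)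

omit [CartesianMonoidalCategory P.FullSubcategory] [IsConvenient P] in
lemma hom_ext_apply {K L : P.FullSubcategory} {f g : K ⟶ L}
    (h : ∀ x, f.hom.hom x = g.hom.hom x) : f = g :=
  ObjectProperty.hom_ext _ (TopCat.ext h)

lemma point_intervalMap (t : unitInterval) (φ : C(unitInterval, unitInterval)) :
    point P t ≫ intervalMap P φ = point P (φ t) := rfl

lemma lift_point_squareMap (s : unitInterval)
    (φ : C(unitInterval × unitInterval, unitInterval)) :
    lift (𝟙 _) (toUnit _ ≫ point P s) ≫ squareMap P φ =
      intervalMap P ⟨fun t ↦ φ (t, s), by fun_prop⟩ := by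
  refine hom_ext_apply P fun x ↦ ?_
  have h₁ := congrArg (fun k ↦ k.hom.hom x)
    (lift_fst (𝟙 (interval P)) (toUnit _ ≫ point P s))
  have h₂ := congrArg (fun k ↦ k.hom.hom x)
    (lift_snd (𝟙 (interval P)) (toUnit _ ≫ point P s))
  exact congrArg₂ (fun a b : ULift unitInterval ↦ ULift.up (φ (a.down, b.down))) h₁ h₂

lemma point_lift_squareMap (t : unitInterval)
    (φ : C(unitInterval × unitInterval, unitInterval)) :
    lift (toUnit _ ≫ point P t) (𝟙 _) ≫ squareMap P φ =
      intervalMap P ⟨fun s ↦ φ (t, s), by fun_prop⟩ := by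
  refine hom_ext_apply P fun x ↦ ?_
  have h₁ := congrArg (fun k ↦ k.hom.hom x)
    (lift_fst (toUnit _ ≫ point P t) (𝟙 (interval P)))
  have h₂ := congrArg (fun k ↦ k.hom.hom x)
    (lift_snd (toUnit _ ≫ point P t) (𝟙 (interval P)))
  exact congrArg₂ (fun a b : ULift unitInterval ↦ ULift.up (φ (a.down, b.down))) h₁ h₂

lemma intervalMap_const (t : unitInterval) :
    intervalMap P (.const _ t) = toUnit _ ≫ point P t := rfl

/-- The first half of the interval. -/
noncomputable def firstHalf : C(unitInterval, unitInterval) :=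
  ⟨fun t ↦ ⟨t / 2, by have := t.2.1; have := t.2.2; constructor <;> linarith⟩, by fun_prop⟩

/-- The second half of the interval. -/
noncomputable def secondHalf : C(unitInterval, unitInterval) :=
  ⟨fun t ↦ ⟨(1 + t) / 2, by have := t.2.1; have := t.2.2; constructor <;> linarith⟩, by fun_prop⟩

/-- Concatenation of paths in an object of a convenient category. -/
lemma exists_concat {K : P.FullSubcategory} (γ₁ γ₂ : interval P ⟶ K)
    (h : point P 1 ≫ γ₁ = point P 0 ≫ γ₂) :
    ∃ γ : interval P ⟶ K, intervalMap P firstHalf ≫ γ = γ₁ ∧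
      intervalMap P secondHalf ≫ γ = γ₂ := by
  have h' : γ₁.hom.hom (ULift.up 1) = γ₂.hom.hom (ULift.up 0) :=
    congrArg (fun k ↦ k.hom.hom ((toUnit (interval P)).hom.hom (ULift.up 0))) h
  let δ₁ : Path (γ₁.hom.hom (ULift.up 0)) (γ₁.hom.hom (ULift.up 1)) :=
    { toFun t := γ₁.hom.hom (ULift.up t)
      continuous_toFun := γ₁.hom.hom.continuous.comp continuous_uliftUp
      source' := rfl
      target' := rfl }
  let δ₂ : Path (γ₁.hom.hom (ULift.up 1)) (γ₂.hom.hom (ULift.up 1)) :=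
    { toFun t := γ₂.hom.hom (ULift.up t)
      continuous_toFun := γ₂.hom.hom.continuous.comp continuous_uliftUp
      source' := h'.symm
      target' := rfl }
  refine ⟨ObjectProperty.homMk (TopCat.ofHom ⟨fun x ↦ δ₁.trans δ₂ x.down,
    (δ₁.trans δ₂).continuous.comp continuous_uliftDown⟩), hom_ext_apply P fun x ↦ ?_,
    hom_ext_apply P fun x ↦ ?_⟩
  · obtain ⟨t⟩ := x
    change δ₁.trans δ₂ (firstHalf t) = δ₁ t
    have : ((firstHalf t : unitInterval) : ℝ) = t / 2 := rfl
    rw [Path.trans_apply, dif_pos (by rw [this]; have := t.2.2; linarith)]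
    congr 1
    ext
    change 2 * ((t : ℝ) / 2) = t
    ring
  · obtain ⟨t⟩ := x
    change δ₁.trans δ₂ (secondHalf t) = δ₂ t
    have ht : ((secondHalf t : unitInterval) : ℝ) = (1 + t) / 2 := rfl
    rw [Path.trans_apply]
    split_ifs with h₀
    · have h₁ : t = 0 := by
        ext
        have := t.2.1
        rw [ht] at h₀
        change (t : ℝ) = 0
        linarith
      subst h₁
      rw [δ₂.source]
      refine Eq.trans ?_ δ₁.target
      congr 1
      ext
      change 2 * ((1 + (0 : ℝ)) / 2) = 1
      norm_num
    · congr 1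
      ext
      change 2 * ((1 + (t : ℝ)) / 2) - 1 = t
      ring

end Interval

/-! ### Homotopies, and the end point fibration of the mapping path object. -/

section Homotopies

open CartesianMonoidalCategory

variable (P : ObjectProperty TopCat.{v}) [CartesianMonoidalCategory P.FullSubcategory]
  [IsConvenient P] {C : Type u} [Category.{v} C] [TopologicallyBicomplete P C]

/-- Maps out of a cylinder are paths in the mapping space. -/
noncomputable def cylEquiv (Z X : C) :
    (cyl P Z ⟶ X) ≃ (interval P ⟶ (Z ⟶[P.FullSubcategory] X)) :=
  (TopologicallyBicomplete.tensor Z (interval P)).homEquiv X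

/-- Maps into a path object are paths in the mapping space. -/
noncomputable def pathEquiv (Z X : C) :
    (Z ⟶ pathObj P X) ≃ (interval P ⟶ (Z ⟶[P.FullSubcategory] X)) :=
  (TopologicallyBicomplete.cotensor X (interval P)).homEquiv Z

lemma cylEquiv_comp {Z X Y : C} (h : cyl P Z ⟶ X) (g : X ⟶ Y) :
    cylEquiv P Z Y (h ≫ g) = cylEquiv P Z X h ≫ eHomWhiskerLeft _ Z g :=
  Tensor.homEquiv_comp _ _ _

lemma pathEquiv_comp {Z Z' X : C} (g : Z' ⟶ Z) (h : Z ⟶ pathObj P X) :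
    pathEquiv P Z' X (g ≫ h) = pathEquiv P Z X h ≫ eHomWhiskerRight _ g X :=
  Cotensor.homEquiv_comp _ _ _

lemma point_cylEquiv (t : unitInterval) {Z X : C} (h : cyl P Z ⟶ X) :
    point P t ≫ cylEquiv P Z X h = eHomEquiv P.FullSubcategory (cylIncl P t Z ≫ h) := by
  rw [eHomEquiv_comp_eq_whiskerLeft, cylIncl, Equiv.apply_symm_apply, Category.assoc]
  rfl

lemma point_pathEquiv (t : unitInterval) {Z X : C} (h : Z ⟶ pathObj P X) :
    point P t ≫ pathEquiv P Z X h = eHomEquiv P.FullSubcategory (h ≫ pathEval P t X) := by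
  rw [eHomEquiv_comp_eq_whiskerRight, pathEval, Equiv.apply_symm_apply, Category.assoc]
  rfl

/-- The projection of the cylinder. -/
noncomputable def cylProj (Z : C) : cyl P Z ⟶ Z :=
  (cylEquiv P Z Z).symm (toUnit _ ≫ eHomEquiv _ (𝟙 Z))

lemma cylEquiv_cylProj_comp {Z X : C} (f : Z ⟶ X) :
    cylEquiv P Z X (cylProj P Z ≫ f) = toUnit _ ≫ eHomEquiv _ f := by
  rw [cylEquiv_comp, cylProj, Equiv.apply_symm_apply, Category.assoc,
    ← eHomEquiv_comp_eq_whiskerLeft, Category.id_comp]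

lemma cylIncl_cylProj (t : unitInterval) (Z : C) : cylIncl P t Z ≫ cylProj P Z = 𝟙 Z := by
  apply (eHomEquiv P.FullSubcategory).injective
  rw [← point_cylEquiv, cylProj, Equiv.apply_symm_apply, reassoc_of% toUnit_unique (point P t ≫ toUnit _) (𝟙 _)]

/-- The constant path. -/
noncomputable def pathConst (Y : C) : Y ⟶ pathObj P Y :=
  (pathEquiv P Y Y).symm (toUnit _ ≫ eHomEquiv _ (𝟙 Y))

lemma pathConst_pathEval (t : unitInterval) (Y : C) :
    pathConst P Y ≫ pathEval P t Y = 𝟙 Y := by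
  apply (eHomEquiv P.FullSubcategory).injective
  rw [← point_pathEquiv, pathConst, Equiv.apply_symm_apply, reassoc_of% toUnit_unique (point P t ≫ toUnit _) (𝟙 _)]

/-- A homotopy is a path in the mapping space. -/
lemma homotopic_iff {X Y : C} (f₀ f₁ : X ⟶ Y) : Homotopic P f₀ f₁ ↔
    ∃ γ : interval P ⟶ (X ⟶[P.FullSubcategory] Y),
      point P 0 ≫ γ = eHomEquiv _ f₀ ∧ point P 1 ≫ γ = eHomEquiv _ f₁ := by
  refine (cylEquiv P X Y).exists_congr fun h ↦ ?_
  rw [point_cylEquiv, point_cylEquiv, (eHomEquiv _).apply_eq_iff_eq,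
    (eHomEquiv _).apply_eq_iff_eq]

variable {P}

lemma Homotopic.of_eq {X Y : C} {f g : X ⟶ Y} (h : f = g) : Homotopic P f g :=
  ⟨cylProj P X ≫ f, by rw [reassoc_of% cylIncl_cylProj],
    by rw [reassoc_of% cylIncl_cylProj, h]⟩

lemma Homotopic.symm {X Y : C} {f g : X ⟶ Y} (h : Homotopic P f g) : Homotopic P g f := by
  rw [homotopic_iff] at h ⊢
  obtain ⟨γ, h₀, h₁⟩ := h
  refine ⟨intervalMap P ⟨unitInterval.symm, unitInterval.continuous_symm⟩ ≫ γ, ?_, ?_⟩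
  · rw [← Category.assoc, point_intervalMap, ← h₁]
    exact congrArg (point P · ≫ γ) unitInterval.symm_zero
  · rw [← Category.assoc, point_intervalMap, ← h₀]
    exact congrArg (point P · ≫ γ) unitInterval.symm_one

lemma firstHalf_zero : firstHalf 0 = 0 := by
  ext; change (0 : ℝ) / 2 = 0; norm_num

lemma secondHalf_one : secondHalf 1 = 1 := by
  ext; change (1 + (1 : ℝ)) / 2 = 1; norm_num

lemma Homotopic.trans {X Y : C} {f g k : X ⟶ Y} (h : Homotopic P f g) (h' : Homotopic P g k) :
    Homotopic P f k := by
  rw [homotopic_iff] at h h' ⊢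
  obtain ⟨γ, h₀, h₁⟩ := h
  obtain ⟨γ', h₀', h₁'⟩ := h'
  obtain ⟨Γ, rfl, rfl⟩ := exists_concat P γ γ' (h₁.trans h₀'.symm)
  refine ⟨Γ, ?_, ?_⟩
  · rw [← Category.assoc, point_intervalMap, firstHalf_zero] at h₀
    exact h₀
  · rw [← Category.assoc, point_intervalMap, secondHalf_one] at h₁'
    exact h₁'

lemma Homotopic.comp_right {X Y Z : C} {f g : X ⟶ Y} (h : Homotopic P f g) (k : Y ⟶ Z) :
    Homotopic P (f ≫ k) (g ≫ k) := by
  obtain ⟨H, rfl, rfl⟩ := h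
  exact ⟨H ≫ k, (Category.assoc _ _ _).symm, (Category.assoc _ _ _).symm⟩

lemma Homotopic.comp_left {X Y Z : C} {f g : Y ⟶ Z} (h : Homotopic P f g) (k : X ⟶ Y) :
    Homotopic P (k ≫ f) (k ≫ g) := by
  rw [homotopic_iff] at h ⊢
  obtain ⟨γ, h₀, h₁⟩ := h
  refine ⟨γ ≫ eHomWhiskerRight _ k Z, ?_, ?_⟩
  · rw [reassoc_of% h₀, eHomEquiv_comp_eq_whiskerRight]
  · rw [reassoc_of% h₁, eHomEquiv_comp_eq_whiskerRight]

/-- With `l'` inverse to `l` and `k` inverse to `l ≫ r`, the inverse is `k ≫ l`: insert `l' ≫ l`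
before `r ≫ k ≫ l`, then contract `l ≫ r ≫ k`. -/
lemma homotopyEquivalences_of_precomp {X Y Z : C} (l : X ⟶ Y) (r : Y ⟶ Z)
    (hl : homotopyEquivalences P l) (h : homotopyEquivalences P (l ≫ r)) :
    homotopyEquivalences P r := by
  obtain ⟨l', hl₁, hl₂⟩ := hl
  obtain ⟨k, hk₁, hk₂⟩ := h
  refine ⟨k ≫ l, ?_, ?_⟩
  · have h₁ := ((hk₁.comp_right l).comp_left l')
    have h₂ := (hl₂.symm.comp_right (r ≫ k ≫ l))
    have h₃ := h₂.trans ((Homotopic.of_eq (by simp)).trans h₁)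
    exact (Homotopic.of_eq (by simp)).trans (h₃.trans ((Homotopic.of_eq (by simp)).trans hl₂))
  · exact (Homotopic.of_eq (by simp)).trans hk₂

/-- Extension of a path along a homotopy of its end point. -/
lemma exists_path_homotopy {Z Y : C} (γ : Z ⟶ pathObj P Y) (H : cyl P Z ⟶ Y)
    (h : γ ≫ pathEval P 1 Y = cylIncl P 0 Z ≫ H) :
    ∃ K : cyl P Z ⟶ pathObj P Y, cylIncl P 0 Z ≫ K = γ ∧ K ≫ pathEval P 1 Y = H ∧
      K ≫ pathEval P 0 Y = cylProj P Z ≫ γ ≫ pathEval P 0 Y := by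
  obtain ⟨Γ, h₁, h₂⟩ := exists_concat P (pathEquiv P Z Y γ) (cylEquiv P Z Y H)
    (by rw [point_pathEquiv, point_cylEquiv, h])
  -- Let `Γ` be `γ` followed by the track of `H`. At time `t` the new path runs along `Γ` on `[0, (1
  -- + t) / 2]`, with `s` the path parameter: `t = 0` gives `γ`, `s = 1` gives `H`, and `s = 0`
  -- stays at the start of `γ`.
  let φ : C(unitInterval × unitInterval, unitInterval) :=
    ⟨fun x ↦ x.2 * secondHalf x.1, by fun_prop⟩
  obtain ⟨g, hg⟩ := ((TopologicallyBicomplete.tensor Z (interval P)).bijective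
    (interval P) Y).2 (squareMap P φ ≫ Γ)
  have hK (s : unitInterval) : cylEquiv P Z Y ((pathEquiv P _ Y).symm g ≫ pathEval P s Y) =
      intervalMap P ⟨fun t ↦ φ (t, s), by fun_prop⟩ ≫ Γ := by
    rw [← lift_point_squareMap, Category.assoc, ← hg]
    refine (comp_eHomWhiskerLeft (V := P.FullSubcategory) _ _).trans ?_
    rw [← point_pathEquiv, Equiv.apply_symm_apply]
    simp only [← Category.assoc]
    congr 1
    ext <;> simp
  refine ⟨(pathEquiv P _ Y).symm g, ?_, ?_, ?_⟩
  · apply (pathEquiv P _ _).injective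
    rw [pathEquiv_comp, Equiv.apply_symm_apply, comp_eHomWhiskerRight, ← h₁]
    have : firstHalf = ⟨fun s ↦ φ (0, s), by fun_prop⟩ := by
      ext s
      change (s : ℝ) / 2 = s * ((1 + 0) / 2)
      ring
    rw [this, ← point_lift_squareMap, Category.assoc, ← hg, cylIncl, Equiv.apply_symm_apply]
    simp only [← Category.assoc]
    congr 1
    ext <;> simp
  · apply (cylEquiv P _ _).injective
    rw [hK, ← h₂]
    congr 2
    ext t
    exact congrArg Subtype.val (one_mul (secondHalf t))
  · apply (cylEquiv P _ _).injective
    rw [hK, cylEquiv_cylProj_comp, ← point_pathEquiv, ← h₁, ← Category.assoc (point P 0),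
      point_intervalMap, firstHalf_zero, ← Category.assoc, ← intervalMap_const]
    congr 2
    ext t
    exact congrArg Subtype.val (zero_mul (secondHalf t))

/-- The end point projection of the mapping path object. -/
noncomputable def mappingPathEnd {X Y : C} (f : X ⟶ Y) : pullback f (pathEval P 0 Y) ⟶ Y :=
  pullback.snd _ _ ≫ pathEval P 1 Y

/-- Keep the point of `X` constant and prolong the path along the homotopy of its end; the start of
the path does not move, so the pair stays in the pullback. -/
lemma hFibrations_mappingPathEnd {X Y : C} (f : X ⟶ Y) :
    hFibrations P (mappingPathEnd (P := P) f) := by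
  refine fun Z ↦ ⟨fun {a H} sq ↦ ?_⟩
  obtain ⟨K, h₁, h₂, h₃⟩ := exists_path_homotopy (a ≫ pullback.snd _ _) H
    (by rw [Category.assoc]; exact sq.w)
  have w : (cylProj P Z ≫ a ≫ pullback.fst _ _) ≫ f = K ≫ pathEval P 0 Y := by
    rw [h₃, Category.assoc, Category.assoc, Category.assoc, pullback.condition]
  refine ⟨⟨⟨pullback.lift _ K w, ?_, ?_⟩⟩⟩
  · apply pullback.hom_ext
    · rw [Category.assoc, pullback.lift_fst, reassoc_of% cylIncl_cylProj]
    · rw [Category.assoc, pullback.lift_snd, h₁]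
  · rw [mappingPathEnd, pullback.lift_snd_assoc, h₂]

/-- Lift the identity of `Y` through the end point projection, starting from constant paths on `X`.
The lift consists of a strict retraction `g` of `f` and a path from `g ≫ f` to the identity. -/
lemma homotopyEquivalences_of_llp {X Y : C} (f : X ⟶ Y) (hf : (hFibrations P).llp f) :
    homotopyEquivalences P f := by
  have := hf _ (hFibrations_mappingPathEnd (P := P) f)
  have sq : CommSq (pullback.lift (𝟙 X) (f ≫ pathConst P Y)
      (by rw [Category.assoc, pathConst_pathEval, Category.id_comp, Category.comp_id])) f
      (mappingPathEnd (P := P) f) (𝟙 Y) := ⟨by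
    rw [mappingPathEnd, pullback.lift_snd_assoc, Category.assoc, pathConst_pathEval]⟩
  refine ⟨sq.lift ≫ pullback.fst _ _, Homotopic.of_eq ?_, (homotopic_iff P _ _).2
    ⟨pathEquiv P _ _ (sq.lift ≫ pullback.snd _ _), ?_, ?_⟩⟩
  · rw [sq.fac_left_assoc, pullback.lift_fst]
  · rw [point_pathEquiv]
    simp only [Category.assoc, pullback.condition]
  · rw [point_pathEquiv, Category.assoc]
    exact congrArg _ sq.fac_right

end Homotopies

/-! ### The interval cylinder as an instance of the abstract one. -/

section IntervalCylinder

variable (P : ObjectProperty TopCat.{v}) [CartesianMonoidalCategory P.FullSubcategory]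
  [IsConvenient P] {C : Type u} [Category.{v} C] [TopologicallyBicomplete P C]

/-- The action of the path object on maps. -/
noncomputable def pathMap {X Y : C} (f : X ⟶ Y) : pathObj P X ⟶ pathObj P Y :=
  (pathEquiv P _ Y).symm (pathEquiv P _ X (𝟙 _) ≫ eHomWhiskerLeft _ _ f)

lemma pathEquiv_comp_pathMap {X Y Z : C} (k : Z ⟶ pathObj P X) (f : X ⟶ Y) :
    pathEquiv P Z Y (k ≫ pathMap P f) = pathEquiv P Z X k ≫ eHomWhiskerLeft _ Z f := by
  rw [pathEquiv_comp, pathMap, Equiv.apply_symm_apply, Category.assoc, eHom_whisker_exchange,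
    ← Category.assoc, ← pathEquiv_comp, Category.comp_id]

variable (C)

/-- The path object functor. -/
noncomputable def pathFunctor : C ⥤ C where
  obj Y := pathObj P Y
  map f := pathMap P f
  map_id X := (pathEquiv P _ _).injective (by
    rw [← Category.id_comp (pathMap P _), pathEquiv_comp_pathMap, eHomWhiskerLeft_id,
      Category.comp_id])
  map_comp f g := (pathEquiv P _ _).injective (by
    rw [pathEquiv_comp_pathMap, ← Category.id_comp (pathMap P _), pathEquiv_comp_pathMap,
      ← Category.id_comp (pathMap P f), pathEquiv_comp_pathMap, eHomWhiskerLeft_comp,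
      Category.assoc])

lemma cylEquiv_trans_pathEquiv_symm_comp (X Y Y' : C) (g : Y ⟶ Y') (h : cyl P X ⟶ Y) :
    ((cylEquiv P X Y').trans (pathEquiv P X Y').symm) (h ≫ g) =
      ((cylEquiv P X Y).trans (pathEquiv P X Y).symm) h ≫ (pathFunctor P C).map g := by
  refine (Equiv.symm_apply_eq _).2 (Eq.trans ?_ (pathEquiv_comp_pathMap P _ _).symm)
  rw [cylEquiv_comp, Equiv.trans_apply, Equiv.apply_symm_apply]

variable {C} in
lemma cylEquiv_symm_pathEquiv_comp {Z Z' : C} (k : Z ⟶ Z') :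
    cylEquiv P Z (cyl P Z') (((cylEquiv P Z (cyl P Z')).trans (pathEquiv P Z (cyl P Z')).symm).symm
      (k ≫ ((cylEquiv P Z' (cyl P Z')).trans (pathEquiv P Z' (cyl P Z')).symm) (𝟙 _))) =
      cylEquiv P Z' (cyl P Z') (𝟙 _) ≫ eHomWhiskerRight _ k _ := by
  rw [Equiv.symm_trans_apply, Equiv.apply_symm_apply, Equiv.symm_symm, pathEquiv_comp,
    Equiv.trans_apply, Equiv.apply_symm_apply]

/-- The cylinders `Z ⊗ I`, with the inclusions of their start. -/
noncomputable def intervalCylinder : Cylinder C where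
  T := Adjunction.leftAdjointOfEquiv (G := pathFunctor P C) (F_obj := fun Z ↦ cyl P Z)
    (fun Z X ↦ (cylEquiv P Z X).trans (pathEquiv P Z X).symm)
    (cylEquiv_trans_pathEquiv_symm_comp P C)
  G := pathFunctor P C
  adj := Adjunction.adjunctionOfEquivLeft _ _
  i := cylIncl P 0
  i_naturality {Z Z'} k := by
    apply (eHomEquiv P.FullSubcategory).injective
    rw [eHomEquiv_comp_eq_whiskerRight]
    refine Eq.trans ?_ (point_cylEquiv P 0 _)
    refine Eq.trans ?_ (congrArg (point P 0 ≫ ·) (cylEquiv_symm_pathEquiv_comp P k).symm)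
    rw [← Category.assoc, point_cylEquiv, Category.comp_id]
    rfl

variable {C}

lemma intervalCylinder_counit (Y : C) : (intervalCylinder P C).adj.counit.app Y =
    (cylEquiv P (pathObj P Y) Y).symm (pathEquiv P (pathObj P Y) Y (𝟙 _)) :=
  Adjunction.adjunctionOfEquivLeft_counit_app _ _ _

/-- The counit is the evaluation homotopy, whose restriction to the start of the cylinder is
evaluation at `0`. The abstract `N` is therefore the mapping path functor of the hypothesis. -/
lemma intervalCylinder_p (Y : C) : (intervalCylinder P C).p Y = pathEval P 0 Y := by
  refine (congrArg (cylIncl P 0 (pathObj P Y) ≫ ·) (intervalCylinder_counit P Y)).trans ?_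
  apply (eHomEquiv P.FullSubcategory).injective
  refine (point_cylEquiv P 0 (X := Y) _).symm.trans ?_
  rw [Equiv.apply_symm_apply, point_pathEquiv, Category.id_comp]

lemma intervalCylinder_N (Y : C) : (intervalCylinder P C).N Y = mappingPath P Y := by
  have h := intervalCylinder_p P Y
  exact congrArg (fun p : pathObj P Y ⟶ Y ↦ Over.pullback p ⋙ Over.forget _) h

end IntervalCylinder

end HurewiczFactorization

open HurewiczFactorization in
theorem mainTheorem2 (P : ObjectProperty TopCat.{v})
    [CartesianMonoidalCategory P.FullSubcategory] [HurewiczFactorization.IsConvenient P]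
    (C : Type u) [Category.{v} C] [HurewiczFactorization.TopologicallyBicomplete P C]
    (hC : HurewiczFactorization.MonomorphismHypothesis P C) :
    ∃ W : HurewiczFactorization.AlgebraicWeakFactorizationSystem C,
      W.rightClass = HurewiczFactorization.hFibrations P ∧
      W.leftClass =
        HurewiczFactorization.strongCofibrations P ⊓
          HurewiczFactorization.homotopyEquivalences P := by
  obtain ⟨E, M, hEM, hE, α, hα, hN⟩ := hC
  let F {X Y : C} (f : X ⟶ Y) : FreeCleavage (intervalCylinder P C) f :=
    Classical.choice (nonempty_freeCleavage (intervalCylinder P C) hEM hE hα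
      (fun φ c h₁ h₂ ↦ by rw [intervalCylinder_N]; exact hN Y φ c h₁ h₂) f)
  have hfib {X Y : C} (f : X ⟶ Y) :
      Nonempty (Cleavage (intervalCylinder P C) f) ↔ hFibrations P f :=
    nonempty_cleavage_iff _ f
  have hllp {X Y : C} (f : X ⟶ Y) :
      (FreeCleavage.awfs F).leftClass f ↔ (hFibrations P).llp f := by
    rw [FreeCleavage.awfs_leftClass]
    exact ⟨fun h _ _ g hg ↦ h g ((hfib g).2 hg), fun h _ _ g hg ↦ h g ((hfib g).1 hg)⟩
  refine ⟨FreeCleavage.awfs F, ?_, ?_⟩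
  · ext X Y f
    rw [FreeCleavage.awfs_rightClass, hfib]
  · ext X Y f
    constructor
    · rw [hllp]
      exact fun h ↦ ⟨fun _ _ g hg ↦ h g hg.1, homotopyEquivalences_of_llp f h⟩
    · rintro ⟨hf, hf'⟩
      -- The unit lies in the left class, hence is a homotopy equivalence, and so is the right
      -- factor by cancellation. The strong cofibration `f` therefore lifts against its own right
      -- factor, which is a coalgebra structure.
      have hl := homotopyEquivalences_of_llp _ ((hllp _).1 (FreeCleavage.awfs_leftClass_l F f))
      have hr := homotopyEquivalences_of_precomp _ (F f).r hl ((F f).fac.symm ▸ hf')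
      have := hf _ ⟨(hfib _).1 ⟨(F f).cleavage⟩, hr⟩
      exact FreeCleavage.awfs_leftClass_of_hasLiftingProperty F f
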